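/- Let $N,T\ge 1$, let $\mu_1,\dots,\mu_N\in\mathbb{C}$ satisfy $|\mu_n|=1$, $\mu_n\neq 1$, and for $t=1,\dots,T$ let $$P_t(\mathbf X)=\sum_{k=1}^{r_t}\langle \alpha^{t,k},\mathbf X\rangle^2+\sum_{n=1}^N c_{t,n}X_n+d_t\in\mathbb{R}[X_1,\dots,X_N],$$ where $r_t\in\mathbb N=\{0,1,2,\dots\}$, $\alpha^{t,k}\in\mathbb{R}^N$, $c_{t,n}>0$ and $d_t\ge 0$. Suppose that $\mathbf a\in\mathbb{N}^N\setminus\{\mathbf 0\}$ satisfies $\langle\alpha^{t,k},\mathbf a\rangle=0$ for all $t,k$. Notation. A real polynomial $P$ in the variables $X_i$ ($i\in I$, $I$ finite) is hypoelliptic if $P(\mathbf x)>0$ for all $\mathbf x\in[1,\infty)^I$ and, for every nonzero multi-index $\beta\in\mathbb N^I$, $\partial^\beta P(\mathbf x)/P(\mathbf x)\to 0$ as $|\mathbf x|=\sum_i|x_i|\to\infty$ in $[1,\infty)^I$. For real polynomials $R_1,\dots,R_T$ in the variables $X_i$ ($i\in I$) and $\nu\in\mathbb{C}^I$, put $$Z(1;R_1,\dots,R_T;\nu;\mathbf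 s)=\sum_{\mathbf m\in\mathbb{Z}_{\ge1}^I}\Big(\prod_{i\in I}\nu_i^{m_i}\Big)\prod_{t=1}^T R_t(\mathbf m)^{-s_t},\qquad \mathbf s\in\mathbb{C}^T$$ (for $I=\emptyset$ this sum has a single term). Let $E(\mathbf a)$ be the set of all $\mathbf m\in\mathbb{Z}_{\ge1}^N$ with $m_n\le a_n$ for at least one $n$, put $\boldsymbol\mu^{\mathbf m}=\prod_n\mu_n^{m_n}$, and $$Z^{\mathbf a}_{N-1}(\mathbf s)=\sum_{\mathbf m\in E(\mathbf a)}\boldsymbol\mu^{\mathbf m}\prod_{t=1}^T P_t(\mathbf m)^{-s_t}.$$ For $I\subsetneq\{1,\dots,N\}$ and $\mathbf b\in\prod_{i\notin I}\{1,\dots,a_i\}$, let $P_t^{\mathbf a,I,\mathbf b}$ be the polynomial in the variables $X_i$ ($i\in I$) obtained from $P_t$ by replacing $X_i$ by $X_i+a_i$ for $i\in I$ and by $b_i$ for $i\notin I$. Then: 1. Each $P_t$ is hypoelliptic, and each $\delta_t:=P_t(\mathbf X+\mathbf a)-P_t(\mathbf X)$ is a real constant. 2. The series $Z(\boldsymbol\mu;\mathbf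 s):=Z(1;P_1,\dots,P_T;\boldsymbol\mu;\mathbf s)$ and $Z^{\mathbf a}_{N-1}(\mathbf s)$ converge absolutely when all $\Re s_t$ are sufficiently large and extend holomorphically to $\mathbb{C}^T$, and for all $\mathbf k\in\mathbb{N}^T$ the extended functions satisfy $$(1-\boldsymbol\mu^{\mathbf a})\,Z(\boldsymbol\mu;-\mathbf k)=\boldsymbol\mu^{\mathbf a}\sum_{\substack{\mathbf u\in\mathbb N^T,\ \mathbf u\le\mathbf k\\ \mathbf u\ne\mathbf k}}\ \prod_{t=1}^T\delta_t^{k_t-u_t}\binom{k_t}{u_t}\;Z(\boldsymbol\mu;-\mathbf u)+Z^{\mathbf a}_{N-1}(-\mathbf k),$$ where $\mathbf u\le\mathbf k$ is meant coordinatewise and $0^0=1$. 3. For all $I\subsetneq\{1,\dots,N\}$ and $\mathbf b\in\prod_{i\notin I}\{1,\dots,a_i\}$ the polynomials $P_t^{\mathbf a,I,\mathbf b}$ are hypoelliptic, and the series $Z(1;P_1^{\mathbf a,I,\mathbf b},\dots,P_T^{\mathbf a,I,\mathbf b};(\mu_i)_{i\in I};\mathbf s)$ converges absolutely when all $\Re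 s_t$ are sufficiently large and extends holomorphically to $\mathbb{C}^T$. For all $\mathbf s\in\mathbb{C}^T$, with the extended functions, $$Z^{\mathbf a}_{N-1}(\mathbf s)=\sum_{I\subsetneq\{1,\dots,N\}}\ \sum_{\mathbf b\in\prod_{i\notin I}\{1,\dots,a_i\}}\Big(\prod_{i\notin I}\mu_i^{b_i}\Big)\Big(\prod_{i\in I}\mu_i^{a_i}\Big)\,Z\big(1;P_1^{\mathbf a,I,\mathbf b},\dots,P_T^{\mathbf a,I,\mathbf b};(\mu_i)_{i\in I};\mathbf s\big).$$ -/

import Mathlib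

open Filter Topology MvPolynomial

noncomputable section

namespace TwistedZeta

variable {ι : Type*}

/-- Partial derivatives of polynomials commute. -/
theorem pderiv_comm (i j : ι) (P : MvPolynomial ι ℝ) :
    pderiv i (pderiv j P) = pderiv j (pderiv i P) := by
  classical
  let D : ι → Derivation ℝ (MvPolynomial ι ℝ) (MvPolynomial ι ℝ) := fun n => pderiv n
  have h : ⁅D i, D j⁆ = 0 := by
    apply MvPolynomial.derivation_ext
    intro k
    simp only [D, Derivation.commutator_apply, pderiv_X, Pi.single_apply]
    split_ifs <;> simp
  have h2 := DFunLike.congr_fun h P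
  simp only [Derivation.commutator_apply, Derivation.zero_apply] at h2
  exact sub_eq_zero.mp h2

instance pderivLeftCommutative :
    LeftCommutative (fun (n : ι) (P : MvPolynomial ι ℝ) => pderiv n P) :=
  ⟨fun i j P => pderiv_comm i j P⟩

/-- `∂^α P` for a multi-index `α`: the partial derivative in the `n`-th variable is applied
`α n` times, for every `n`. -/
def multiDeriv (α : ι →₀ ℕ) (P : MvPolynomial ι ℝ) : MvPolynomial ι ℝ :=
  (Finsupp.toMultiset α).foldr (fun n p => pderiv n p) P

/-- The orthant `[1, +∞[^ι`. -/
def orthant (ι : Type*) : Set (ι → ℝ) := {x | ∀ n, 1 ≤ x n}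

/-- The filter `|x| → +∞`, `x ∈ [1, +∞[^ι`, where `|x| = ∑ |x_n|`. -/
def orthantAtTop (ι : Type*) [Fintype ι] : Filter (ι → ℝ) :=
  comap (fun x : ι → ℝ => ∑ n, |x n|) atTop ⊓ 𝓟 (orthant ι)

/-- Hypoelliptic polynomials: `P > 0` on `[1, +∞[^ι`, and `∂^α P / P → 0` as `|x| → +∞` in
`[1, +∞[^ι`, for every multi-index `α ≠ 0`. -/
def Hypoelliptic [Fintype ι] (P : MvPolynomial ι ℝ) : Prop :=
  (∀ x ∈ orthant ι, 0 < eval x P) ∧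
    ∀ α : ι →₀ ℕ, α ≠ 0 →
      Tendsto (fun x => eval x (multiDeriv α P) / eval x P) (orthantAtTop ι) (𝓝 0)

/-- The polynomial `P(X + a)`. -/
def shift (a : ι → ℕ) (P : MvPolynomial ι ℝ) : MvPolynomial ι ℝ :=
  aeval (fun n => X n + C (a n : ℝ)) P

/-- The polynomial `Δ_a P = P(X + a) - P(X)`. -/
def diff (a : ι → ℕ) (P : MvPolynomial ι ℝ) : MvPolynomial ι ℝ := shift a P - P

/-- The polynomial `P^{a,I,b}` in the variables indexed by `I`: `X_i` is replaced by `X_i + a_i`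
for `i ∈ I` and by the constant `b_i` for `i ∉ I`. -/
def restrict [DecidableEq ι] (a : ι → ℕ) (I : Finset ι) (b : {i // i ∉ I} → ℕ)
    (P : MvPolynomial ι ℝ) : MvPolynomial {i // i ∈ I} ℝ :=
  aeval (fun i => if h : i ∈ I then X ⟨i, h⟩ + C (a i : ℝ) else C (b ⟨i, h⟩ : ℝ)) P

/-- The points with positive integer coordinates. -/
def posPoints (ι : Type*) : Set (ι → ℕ) := {m | ∀ n, 1 ≤ m n}

/-- The set `E(a)` of the points `m` with positive integer coordinates with `m_n ≤ a_n` for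
at least one `n`. -/
def boundarySet (a : ι → ℕ) : Set (ι → ℕ) := {m | (∀ n, 1 ≤ m n) ∧ ∃ n, m n ≤ a n}

/-- The term `μ^m Q(m) ∏_t P_t(m)^{-s_t}`. -/
def zetaTerm [Fintype ι] {T : ℕ} (Q : MvPolynomial ι ℝ) (P : Fin T → MvPolynomial ι ℝ)
    (μ : ι → ℂ) (s : Fin T → ℂ) (m : ι → ℕ) : ℂ :=
  (∏ n, μ n ^ m n) * ((eval (fun n => (m n : ℝ)) Q : ℝ) : ℂ) *
    ∏ t, ((eval (fun n => (m n : ℝ)) (P t) : ℝ) : ℂ) ^ (-s t)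

/-- `F` is entire on `ℂ^T`, and it is the sum of the absolutely convergent series
`∑_{m ∈ E} μ^m Q(m) ∏_t P_t(m)^{-s_t}` as soon as all the real parts `Re s_t` are large enough.
For `E = posPoints ι` the series is `Z(Q; P_1, …, P_T; μ; s)`. -/
def IsEntireContinuation [Fintype ι] {T : ℕ} (E : Set (ι → ℕ)) (Q : MvPolynomial ι ℝ)
    (P : Fin T → MvPolynomial ι ℝ) (μ : ι → ℂ) (F : (Fin T → ℂ) → ℂ) : Prop :=
  Differentiable ℂ F ∧
    ∃ σ₀ : ℝ, ∀ s : Fin T → ℂ, (∀ t, σ₀ < (s t).re) →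
      Summable (fun m : E => ‖zetaTerm Q P μ s m‖) ∧ F s = ∑' m : E, zetaTerm Q P μ s m

end TwistedZeta

end

/-!
# Continuation and recurrence for twisted multiple zeta functions

The idea is to sum the series after multiplying a generating power series by a polynomial whose
coefficients add up to `1`. Let `G_s` be the power series in the variables `X_i` whose coefficient
at `m - 1` is the term of the zeta series at `m` (`zetaSeries`), and let `p = ∏_i (1 - μ_i X_i) /
(1 - μ_i)` (`regFactor`), which makes sense as `μ_i ≠ 1`. Multiplying by `p` does not change the
sum of an absolutely convergent series of coefficients, while the coefficients of `p ^ K * G_s`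
are `K`-th differences of `∏_t P_t(m)^{-s_t}` in all the directions; multiplication by power
series extends the terms by zero outside the orthant, so summation by parts produces no boundary
terms. The sum of the coefficients of `p ^ K * G_s`, for `K` large, is thus a regularized sum of
the series (`RegularizedSum`). It is linear in the series and does not depend on `K`.

The differences are small because each `P_t` is a sum of squares of affine forms plus a linear
form with positive coefficients (`IsSosLinear`): on the orthant it lies between multiples of `|x|`
and `|x|²`, and its partial derivatives are `O(√P_t)`. Hence moving a coordinate by a complex
number of modulus less than `ε √|x|` changes `P_t(x)` by at most half of it, the terms extend
holomorphically to such discs, and Cauchy's estimate shows that each difference gains a factor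
`|x|^{-1/2}` (`decaysIn_zetaSeries`). At a point `m` it is enough to use the differences in the
direction of the largest coordinate of `m`; finitely many points have only small coordinates. This
gives a summable majorant, uniform for bounded `s` (`exists_majorant`), hence an entire function
of `s`, which is the sum of the series where this converges absolutely
(`exists_isEntireContinuation`). The same estimate of the derivatives yields hypoellipticity. The
class of polynomials is stable under the substitutions that define `P_t^{a,I,b}`.

The remaining statements are algebra. The set `E(a)` is a disjoint union of copies of orthants in
fewer variables, which gives the continuation of the series over `E(a)`. The other points with
positive coordinates form the orthant shifted by `a`, on which `P_t` becomes `P_t + δ_t`; by the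
identity theorem `Z(s) = Z_bd(s) + μ^a Z_δ(s)` for all `s`, where `Z_δ` is the zeta function of
the polynomials `P_t + δ_t`. At `s = -k` the terms of `Z_δ` are expanded by the binomial theorem
(`zetaSeries_add_C`), and the linearity of the regularized sum expresses `Z_δ(-k)` by the values
`Z(-u)` with `u ≤ k`.
-/

noncomputable section

namespace TwistedZeta

/-! ### Regularized summation of power series -/

section Regularization

variable {ι : Type*}

/-- Summing the coefficients: multiplication by `1 - c X_i` multiplies the sum by `1 - c`. -/
theorem hasSum_coeff_one_sub_mul (i : ι) (c : ℂ) {G : MvPowerSeries ι ℂ} {v : ℂ}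
    (h : HasSum (fun k => MvPowerSeries.coeff k G) v) :
    HasSum (fun k => MvPowerSeries.coeff k
      ((1 - MvPowerSeries.C c * MvPowerSeries.X i) * G)) ((1 - c) * v) := by
  classical
  have hinj : Function.Injective (fun k : ι →₀ ℕ => Finsupp.single i 1 + k) :=
    add_right_injective _
  have hX : HasSum (fun k => MvPowerSeries.coeff k (MvPowerSeries.X i * G)) v := by
    refine (hinj.hasSum_iff ?_).mp ?_
    · intro k hk
      rw [MvPowerSeries.X_def, MvPowerSeries.coeff_monomial_mul, if_neg]
      intro hle
      exact hk ⟨k - Finsupp.single i 1, add_tsub_cancel_of_le hle⟩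
    · simpa [Function.comp_def, MvPowerSeries.X_def, MvPowerSeries.coeff_add_monomial_mul] using h
  simp only [sub_mul, one_mul]
  convert! h.sub (hX.mul_left c) using 2 with k
  rw [map_sub, mul_assoc, MvPowerSeries.coeff_C_mul]

variable [Fintype ι]

/-- The polynomial `∏_i (1 - μ_i X_i) / (1 - μ_i)`, seen as a power series. The sum of its
coefficients is `1`, so multiplying by it does not change the sum of the coefficients of a series;
it replaces the coefficients by their twisted differences in all the variables. -/
def regFactor (μ : ι → ℂ) : MvPowerSeries ι ℂ :=
  ∏ i, (MvPowerSeries.C (1 - μ i)⁻¹ * (1 - MvPowerSeries.C (μ i) * MvPowerSeries.X i))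

/-- `v` is the regularized sum of the coefficients of `G`: it is their ordinary (unconditional) sum
after `G` has been multiplied by some power of `regFactor μ`. -/
def RegularizedSum (μ : ι → ℂ) (G : MvPowerSeries ι ℂ) (v : ℂ) : Prop :=
  ∃ K : ℕ, HasSum (fun k => MvPowerSeries.coeff k (regFactor μ ^ K * G)) v

theorem hasSum_coeff_regFactor_mul {μ : ι → ℂ} (hμ : ∀ i, μ i ≠ 1) {G : MvPowerSeries ι ℂ} {v : ℂ}
    (h : HasSum (fun k => MvPowerSeries.coeff k G) v) :
    HasSum (fun k => MvPowerSeries.coeff k (regFactor μ * G)) v := by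
  classical
  unfold regFactor
  induction (Finset.univ : Finset ι) using Finset.induction_on with
  | empty => simpa using h
  | insert i s hi ih =>
    rw [Finset.prod_insert hi]
    have h1 := (hasSum_coeff_one_sub_mul i (μ i) ih).mul_left (1 - μ i)⁻¹
    rw [inv_mul_cancel_left₀ (sub_ne_zero.mpr (hμ i).symm)] at h1
    convert! h1 using 2 with k
    rw [← MvPowerSeries.coeff_C_mul, mul_assoc, mul_assoc]

theorem hasSum_coeff_regFactor_pow_mul {μ : ι → ℂ} (hμ : ∀ i, μ i ≠ 1) {G : MvPowerSeries ι ℂ}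
    {v : ℂ} {K L : ℕ} (hKL : K ≤ L)
    (h : HasSum (fun k => MvPowerSeries.coeff k (regFactor μ ^ K * G)) v) :
    HasSum (fun k => MvPowerSeries.coeff k (regFactor μ ^ L * G)) v := by
  induction L, hKL using Nat.le_induction with
  | base => exact h
  | succ L _ ih =>
    rw [pow_succ', mul_assoc]
    exact hasSum_coeff_regFactor_mul hμ ih

theorem RegularizedSum.unique {μ : ι → ℂ} (hμ : ∀ i, μ i ≠ 1) {G : MvPowerSeries ι ℂ} {v w : ℂ}
    (hv : RegularizedSum μ G v) (hw : RegularizedSum μ G w) : v = w := by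
  obtain ⟨K, hK⟩ := hv
  obtain ⟨L, hL⟩ := hw
  exact (hasSum_coeff_regFactor_pow_mul hμ (le_max_left K L) hK).unique
    (hasSum_coeff_regFactor_pow_mul hμ (le_max_right K L) hL)

theorem RegularizedSum.add {μ : ι → ℂ} (hμ : ∀ i, μ i ≠ 1) {G H : MvPowerSeries ι ℂ} {v w : ℂ}
    (hv : RegularizedSum μ G v) (hw : RegularizedSum μ H w) : RegularizedSum μ (G + H) (v + w) := by
  obtain ⟨K, hK⟩ := hv
  obtain ⟨L, hL⟩ := hw
  refine ⟨max K L, ?_⟩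
  simpa only [mul_add, map_add] using
    (hasSum_coeff_regFactor_pow_mul hμ (le_max_left K L) hK).add
      (hasSum_coeff_regFactor_pow_mul hμ (le_max_right K L) hL)

theorem RegularizedSum.const_smul {μ : ι → ℂ} {G : MvPowerSeries ι ℂ} {v : ℂ} (c : ℂ)
    (hv : RegularizedSum μ G v) : RegularizedSum μ (c • G) (c * v) := by
  obtain ⟨K, hK⟩ := hv
  refine ⟨K, ?_⟩
  simpa only [mul_smul_comm, map_smul, smul_eq_mul] using hK.mul_left c

theorem RegularizedSum.sum {μ : ι → ℂ} (hμ : ∀ i, μ i ≠ 1) {κ : Type*} (s : Finset κ)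
    {G : κ → MvPowerSeries ι ℂ} {v : κ → ℂ} (h : ∀ u ∈ s, RegularizedSum μ (G u) (v u)) :
    RegularizedSum μ (∑ u ∈ s, G u) (∑ u ∈ s, v u) := by
  classical
  induction s using Finset.induction_on with
  | empty => exact ⟨0, by simp [hasSum_zero]⟩
  | insert u s hu ih =>
    rw [Finset.sum_insert hu, Finset.sum_insert hu]
    exact (h u (Finset.mem_insert_self u s)).add hμ
      (ih fun x hx => h x (Finset.mem_insert_of_mem hx))

end Regularization

/-! ### Holomorphic series in several variables -/

section Holomorphic

variable {E : Type*} [NormedAddCommGroup E] [NormedSpace ℂ E]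

/-- Cauchy's estimate for the differential of a function of several variables, obtained by
restricting the function to complex lines. -/
theorem norm_fderiv_le_of_norm_le {f : E → ℂ} {x : E} {r M : ℝ} (hr : 0 < r)
    (hf : ∀ y ∈ Metric.closedBall x r, DifferentiableAt ℂ f y)
    (hM : ∀ y ∈ Metric.closedBall x r, ‖f y‖ ≤ M) : ‖fderiv ℂ f x‖ ≤ M / r := by
  have hM0 : 0 ≤ M := (norm_nonneg _).trans (hM x (Metric.mem_closedBall_self hr.le))
  refine ContinuousLinearMap.opNorm_le_of_unit_norm (𝕜 := ℂ) (by positivity) fun v hv => ?_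
  let γ : ℂ → E := fun z => x + z • v
  have hγ : ∀ z, HasDerivAt γ v z := fun z => by
    have h := ((hasDerivAt_id z).smul_const v).const_add x
    rw [one_smul] at h
    exact h
  have hmem : ∀ z ∈ Metric.closedBall (0 : ℂ) r, γ z ∈ Metric.closedBall x r := fun z hz => by
    simpa [γ, mem_closedBall_iff_norm, norm_smul, hv] using hz
  have hd : ∀ z ∈ Metric.closedBall (0 : ℂ) r,
      HasDerivAt (f ∘ γ) (fderiv ℂ f (γ z) v) z := fun z hz =>
    (hf _ (hmem z hz)).hasFDerivAt.comp_hasDerivAt z (hγ z)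
  have h0 := hd 0 (Metric.mem_closedBall_self hr.le)
  have hγ0 : γ 0 = x := by simp [γ]
  rw [hγ0] at h0
  rw [← h0.deriv]
  refine Complex.norm_deriv_le_of_forall_mem_sphere_norm_le hr ?_ fun z hz =>
    hM _ (hmem z (Metric.sphere_subset_closedBall hz))
  refine DifferentiableOn.diffContOnCl fun z hz => ?_
  rw [closure_ball _ hr.ne'] at hz
  exact (hd z hz).differentiableAt.differentiableWithinAt

/-- A series of entire functions of several variables which has a summable majorant on a ball, up
to finitely many terms, is holomorphic on this ball. -/
theorem differentiableAt_tsum_of_norm_le [ProperSpace E] {κ : Type*} {f : κ → E → ℂ} {u : κ → ℝ}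
    {B : ℝ} (hu : Summable u) (hf : ∀ k, Differentiable ℂ (f k))
    (hfu : ∀ᶠ k in cofinite, ∀ s ∈ Metric.closedBall (0 : E) B, ‖f k s‖ ≤ u k)
    {s : E} (hs : s ∈ Metric.ball (0 : E) B) :
    DifferentiableAt ℂ (fun s => ∑' k, f k s) s := by
  classical
  have hb : ∀ k, ∃ b, ∀ s ∈ Metric.closedBall (0 : E) B, ‖f k s‖ ≤ b := fun k =>
    (isCompact_closedBall (0 : E) B).exists_bound_of_continuousOn (hf k).continuous.continuousOn
  choose b hb using hb
  -- the finitely many exceptional terms are bounded by compactness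
  let w : κ → ℝ := fun k =>
    if ∀ s ∈ Metric.closedBall (0 : E) B, ‖f k s‖ ≤ u k then u k else b k
  have hw : Summable w := by
    refine hu.congr_cofinite ?_
    filter_upwards [hfu] with k hk
    simp only [w]
    rw [if_pos hk]
  have hfw : ∀ k, ∀ s ∈ Metric.closedBall (0 : E) B, ‖f k s‖ ≤ w k := by
    intro k s hs
    simp only [w]
    split_ifs with h
    exacts [h s hs, hb k s hs]
  obtain ⟨r, hr, hrB⟩ : ∃ r > 0, Metric.closedBall s (2 * r) ⊆ Metric.closedBall 0 B := by
    refine ⟨(B - ‖s‖) / 2, by have := mem_ball_zero_iff.mp hs; linarith, fun y hy => ?_⟩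
    rw [mem_closedBall_iff_norm] at hy
    rw [mem_closedBall_zero_iff]
    have := norm_le_norm_add_norm_sub' y s
    linarith
  have hsub : ∀ y ∈ Metric.ball s r, Metric.closedBall y r ⊆ Metric.closedBall 0 B := by
    intro y hy
    refine (Metric.closedBall_subset_closedBall' ?_).trans hrB
    have := Metric.mem_ball.mp hy
    linarith
  refine (hasFDerivAt_tsum_of_isPreconnected (hw.div_const r) Metric.isOpen_ball
    (convex_ball s r).isPreconnected (fun k x _ => ((hf k) x).hasFDerivAt)
    (fun k x hx => norm_fderiv_le_of_norm_le hr (fun y _ => hf k y)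
      fun y hy => hfw k y (hsub x hx hy)) (Metric.mem_ball_self hr)
    (hw.of_norm_bounded fun k => hfw k s (Metric.ball_subset_closedBall hs))
    (Metric.mem_ball_self hr)).differentiableAt

/-- Two entire functions of several variables that agree far away in the direction of
`(1, …, 1)` are equal. -/
theorem eq_of_eq_of_re_large {T : ℕ} {F G : (Fin T → ℂ) → ℂ} (hF : Differentiable ℂ F)
    (hG : Differentiable ℂ G) {σ : ℝ} (h : ∀ s : Fin T → ℂ, (∀ t, σ < (s t).re) → F s = G s) :
    F = G := by
  funext s
  let γ : ℂ → Fin T → ℂ := fun z t => s t + z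
  have hγ : Differentiable ℂ γ := by fun_prop
  obtain ⟨ρ, hρ⟩ : ∃ ρ : ℝ, ∀ t, σ - (s t).re < ρ :=
    ⟨∑ t, |σ - (s t).re| + 1, fun t => by
      have := Finset.single_le_sum (fun t _ => abs_nonneg (σ - (s t).re)) (Finset.mem_univ t)
      have := le_abs_self (σ - (s t).re)
      linarith⟩
  have hev : F ∘ γ =ᶠ[𝓝 ((ρ + 1 : ℝ) : ℂ)] G ∘ γ := by
    have hopen : IsOpen {z : ℂ | ρ < z.re} := isOpen_lt continuous_const Complex.continuous_re
    filter_upwards [hopen.mem_nhds (show ρ < ((ρ + 1 : ℝ) : ℂ).re by simp)] with z hz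
    refine h _ fun t => ?_
    have := hρ t
    simp only [γ, Complex.add_re]
    have hz' : ρ < z.re := hz
    linarith
  have := AnalyticOnNhd.eq_of_eventuallyEq
    (fun z _ => (hF.comp hγ).analyticAt z) (fun z _ => (hG.comp hγ).analyticAt z) hev
  simpa [γ] using congrFun this 0

end Holomorphic

/-- The series `∑_k ∏_l g_l(k_l)` converges if each `g_l` is nonnegative and summable. -/
theorem summable_prod_apply {ι : Type*} [Fintype ι] {g : ι → ℕ → ℝ} (h0 : ∀ l n, 0 ≤ g l n)
    (hg : ∀ l, Summable (g l)) : Summable fun k : ι →₀ ℕ => ∏ l, g l (k l) := by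
  classical
  have h : Summable fun k : ι → ℕ => ∏ l, g l (k l) := by
    refine summable_of_sum_le (c := ∏ l, ∑' n, g l n)
      (fun k => Finset.prod_nonneg fun l _ => h0 l _) fun u => ?_
    calc ∑ k ∈ u, ∏ l, g l (k l)
        ≤ ∑ k ∈ Fintype.piFinset fun l => u.image fun k => k l, ∏ l, g l (k l) := by
          refine Finset.sum_le_sum_of_subset_of_nonneg (fun k hk => ?_)
            fun k _ _ => Finset.prod_nonneg fun l _ => h0 l _
          exact Fintype.mem_piFinset.mpr fun l => Finset.mem_image_of_mem _ hk
      _ = ∏ l, ∑ n ∈ u.image fun k => k l, g l n := (Finset.prod_univ_sum _ _).symm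
      _ ≤ ∏ l, ∑' n, g l n := Finset.prod_le_prod
          (fun l _ => Finset.sum_nonneg fun n _ => h0 l n)
          fun l _ => (hg l).sum_le_tsum _ fun n _ => h0 l n
  exact (Finsupp.equivFunOnFinite : (ι →₀ ℕ) ≃ (ι → ℕ)).summable_iff.mpr h

/-! ### Iterated differences -/

section Differences

/-- The backward difference `h(z) - h(z - 1)`. -/
def backwardDiff (h : ℂ → ℂ) : ℂ → ℂ := fun z => h z - h (z - 1)

theorem backwardDiff_norm_le {h : ℂ → ℂ} {R r M : ℝ} (hr : 1 ≤ r)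
    (hd : ∀ z ∈ Metric.ball (0 : ℂ) R, DifferentiableAt ℂ h z)
    (hM : ∀ z ∈ Metric.ball (0 : ℂ) R, ‖h z‖ ≤ M) :
    (∀ z ∈ Metric.ball (0 : ℂ) (R - 2 * r), DifferentiableAt ℂ (backwardDiff h) z) ∧
      ∀ z ∈ Metric.ball (0 : ℂ) (R - 2 * r), ‖backwardDiff h z‖ ≤ M / r := by
  have hmem : ∀ z ∈ Metric.ball (0 : ℂ) (R - 2 * r), z ∈ Metric.ball (0 : ℂ) (R - r) ∧
      z - 1 ∈ Metric.ball (0 : ℂ) (R - r) := by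
    intro z hz
    rw [mem_ball_zero_iff] at hz
    have h1 : ‖z - 1‖ ≤ ‖z‖ + 1 := by simpa using norm_sub_le z 1
    constructor <;> rw [mem_ball_zero_iff] <;> linarith
  have hsub : Metric.ball (0 : ℂ) (R - r) ⊆ Metric.ball 0 R :=
    Metric.ball_subset_ball (by linarith)
  refine ⟨fun z hz => ?_, fun z hz => ?_⟩
  · refine (hd z (hsub (hmem z hz).1)).sub ?_
    exact DifferentiableAt.comp z (hd (z - 1) (hsub (hmem z hz).2)) (by fun_prop)
  · have hb : ∀ w ∈ Metric.ball (0 : ℂ) (R - r), ‖fderiv ℂ h w‖ ≤ M / r := by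
      intro w hw
      have hball : Metric.closedBall w r ⊆ Metric.ball 0 R := by
        refine Metric.closedBall_subset_ball' ?_
        have := Metric.mem_ball.mp hw
        linarith
      exact norm_fderiv_le_of_norm_le (by linarith) (fun y hy => hd y (hball hy))
        fun y hy => hM y (hball hy)
    have := (convex_ball (0 : ℂ) (R - r)).norm_image_sub_le_of_norm_fderiv_le
      (fun w hw => hd w (hsub hw)) hb (hmem z hz).2 (hmem z hz).1
    simpa [backwardDiff] using this

/-- If `h` is holomorphic and bounded by `M` on a disc of radius greater than `2 K r`, then its
`K`-th difference at the centre is at most `M / r ^ K`. -/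
theorem norm_iterate_backwardDiff_le {h : ℂ → ℂ} {R r M : ℝ} (hr : 1 ≤ r) (K : ℕ)
    (hR : 2 * K * r < R)
    (hd : ∀ z ∈ Metric.ball (0 : ℂ) R, DifferentiableAt ℂ h z)
    (hM : ∀ z ∈ Metric.ball (0 : ℂ) R, ‖h z‖ ≤ M) :
    ‖backwardDiff^[K] h 0‖ ≤ M / r ^ K := by
  induction K generalizing h R M with
  | zero =>
    simpa using hM 0 (Metric.mem_ball_self (by simpa using hR))
  | succ K ih =>
    obtain ⟨h1, h2⟩ := backwardDiff_norm_le hr hd hM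
    rw [Function.iterate_succ_apply, pow_succ', ← div_div]
    refine ih ?_ h1 h2
    push_cast at hR
    linarith

variable {ι : Type*}

theorem coeff_one_sub_mul_single_add (i : ι) (c : ℂ) (G : MvPowerSeries ι ℂ) (k : ι →₀ ℕ) :
    MvPowerSeries.coeff (Finsupp.single i 1 + k)
      ((1 - MvPowerSeries.C c * MvPowerSeries.X i) * G) =
      MvPowerSeries.coeff (Finsupp.single i 1 + k) G - c * MvPowerSeries.coeff k G := by
  rw [sub_mul, one_mul, map_sub, mul_assoc, MvPowerSeries.coeff_C_mul, MvPowerSeries.X_def,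
    MvPowerSeries.coeff_add_monomial_mul, one_mul]

/-- Multiplication by `(1 - c X_i) ^ K` takes the `K`-th twisted difference of the coefficients in
the `i`-th direction. -/
theorem coeff_one_sub_pow_mul (i : ι) (c w z : ℂ) (G : MvPowerSeries ι ℂ) (k : ι →₀ ℕ)
    (h : ℂ → ℂ)
    (hG : ∀ n : ℕ, MvPowerSeries.coeff (Finsupp.single i n + k) G = w * c ^ n * h (n + z))
    (K n : ℕ) :
    MvPowerSeries.coeff (Finsupp.single i (n + K) + k)
      ((1 - MvPowerSeries.C c * MvPowerSeries.X i) ^ K * G) =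
      w * c ^ (n + K) * backwardDiff^[K] h ((n + K : ℕ) + z) := by
  induction K generalizing n with
  | zero => simpa using hG n
  | succ K ih =>
    have hs : Finsupp.single i (n + (K + 1)) + k =
        Finsupp.single i 1 + (Finsupp.single i (n + K) + k) := by
      rw [← add_assoc (Finsupp.single i 1), ← Finsupp.single_add]
      congr 2
      ring
    rw [Function.iterate_succ_apply', pow_succ', mul_assoc, hs, coeff_one_sub_mul_single_add,
      ← hs, show n + (K + 1) = (n + 1) + K by ring, ih (n + 1), ih n, backwardDiff]
    rw [show ((n + 1 + K : ℕ) : ℂ) + z - 1 = ((n + K : ℕ) : ℂ) + z by push_cast; ring]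
    ring

/-- At the exponents `k` with `k_i ≥ M`, the coefficients of `G` are at most `C / (1 + k_i) ^ D`.
Up to the constant `C`, this property survives the multiplication by polynomials in the other
variables. -/
def DecaysIn (i : ι) (C : ℝ) (M D : ℕ) (G : MvPowerSeries ι ℂ) : Prop :=
  ∀ k : ι →₀ ℕ, M ≤ k i → ‖MvPowerSeries.coeff k G‖ ≤ C / (1 + (k i : ℝ)) ^ D

theorem DecaysIn.C_mul {i : ι} {C : ℝ} {M D : ℕ} {G : MvPowerSeries ι ℂ} (h : DecaysIn i C M D G)
    (c : ℂ) : DecaysIn i (‖c‖ * C) M D (MvPowerSeries.C c * G) := by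
  intro k hk
  rw [MvPowerSeries.coeff_C_mul, norm_mul, mul_div_assoc]
  exact mul_le_mul_of_nonneg_left (h k hk) (norm_nonneg _)

theorem DecaysIn.one_sub_mul {i : ι} {C : ℝ} {M D : ℕ} {G : MvPowerSeries ι ℂ}
    (h : DecaysIn i C M D G) {j : ι} (hj : j ≠ i) (c : ℂ) (hC : 0 ≤ C) :
    DecaysIn i ((1 + ‖c‖) * C) M D ((1 - MvPowerSeries.C c * MvPowerSeries.X j) * G) := by
  classical
  intro k hk
  have h1 : ‖MvPowerSeries.coeff k (MvPowerSeries.X j * G)‖ ≤ C / (1 + (k i : ℝ)) ^ D := by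
    rw [MvPowerSeries.X_def, MvPowerSeries.coeff_monomial_mul, one_mul]
    split_ifs
    · have := h (k - Finsupp.single j 1)
      simp only [Finsupp.tsub_apply, Finsupp.single_apply, if_neg hj, tsub_zero] at this
      exact this hk
    · rw [norm_zero]
      positivity
  rw [sub_mul, one_mul, map_sub, mul_assoc, MvPowerSeries.coeff_C_mul]
  calc _ ≤ _ := norm_sub_le _ _
    _ ≤ C / (1 + (k i : ℝ)) ^ D + ‖c‖ * (C / (1 + (k i : ℝ)) ^ D) := by
      rw [norm_mul]
      gcongr
      exact h k hk
    _ = _ := by ring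

/-- The constant does not depend on the series: this is what makes the estimates locally uniform
in the parameter `s`. -/
theorem DecaysIn.regFactor_pow_mul [Fintype ι] (μ : ι → ℂ) (i : ι) {C : ℝ} (hC : 0 ≤ C)
    (M D K : ℕ) :
    ∃ C' : ℝ, 0 ≤ C' ∧ ∀ G : MvPowerSeries ι ℂ,
      DecaysIn i C M D ((1 - MvPowerSeries.C (μ i) * MvPowerSeries.X i) ^ K * G) →
        DecaysIn i C' M D (regFactor μ ^ K * G) := by
  classical
  -- the factors in the variables other than `X_i`, one at a time
  have hfac : ∀ j, j ≠ i → ∀ (L : ℕ) (C : ℝ), 0 ≤ C → ∃ C' : ℝ, 0 ≤ C' ∧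
      ∀ H : MvPowerSeries ι ℂ, DecaysIn i C M D H → DecaysIn i C' M D
        ((MvPowerSeries.C (1 - μ j)⁻¹ *
          (1 - MvPowerSeries.C (μ j) * MvPowerSeries.X j)) ^ L * H) := by
    intro j hj L
    induction L with
    | zero => exact fun C hC => ⟨C, hC, fun H hH => by simpa using hH⟩
    | succ L ih =>
      intro C hC
      obtain ⟨C', hC', h'⟩ := ih (‖(1 - μ j)⁻¹‖ * ((1 + ‖μ j‖) * C)) (by positivity)
      refine ⟨C', hC', fun H hH => ?_⟩
      rw [pow_succ, mul_assoc, mul_assoc]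
      exact h' _ ((hH.one_sub_mul hj (μ j) hC).C_mul _)
  have hprod : ∀ s : Finset ι, i ∉ s → ∀ C : ℝ, 0 ≤ C → ∃ C' : ℝ, 0 ≤ C' ∧
      ∀ H : MvPowerSeries ι ℂ, DecaysIn i C M D H → DecaysIn i C' M D
        ((∏ j ∈ s, (MvPowerSeries.C (1 - μ j)⁻¹ *
          (1 - MvPowerSeries.C (μ j) * MvPowerSeries.X j)) ^ K) * H) := by
    intro s
    induction s using Finset.induction_on with
    | empty => exact fun _ C hC => ⟨C, hC, fun H hH => by simpa using hH⟩
    | insert j s hj ih =>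
      intro hi C hC
      rw [Finset.mem_insert, not_or] at hi
      obtain ⟨C₁, hC₁, h₁⟩ := ih hi.2 C hC
      obtain ⟨C₂, hC₂, h₂⟩ := hfac j (Ne.symm hi.1) K C₁ hC₁
      refine ⟨C₂, hC₂, fun H hH => ?_⟩
      rw [Finset.prod_insert hj, mul_assoc]
      exact h₂ _ (h₁ H hH)
  obtain ⟨C', hC', h'⟩ := hprod (Finset.univ.erase i) (Finset.notMem_erase i _)
    (‖((1 - μ i)⁻¹) ^ K‖ * C) (by positivity)
  refine ⟨C', hC', fun G hG => ?_⟩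
  have heq : regFactor μ ^ K * G = (∏ j ∈ Finset.univ.erase i, (MvPowerSeries.C (1 - μ j)⁻¹ *
      (1 - MvPowerSeries.C (μ j) * MvPowerSeries.X j)) ^ K) *
      (MvPowerSeries.C (((1 - μ i)⁻¹) ^ K) *
        ((1 - MvPowerSeries.C (μ i) * MvPowerSeries.X i) ^ K * G)) := by
    rw [regFactor, ← Finset.prod_pow, ← Finset.prod_erase_mul _ _ (Finset.mem_univ i), mul_pow,
      map_pow]
    simp only [mul_assoc]
  rw [heq]
  exact h' _ (hG.C_mul _)

end Differences

/-! ### Sums of squares of affine forms plus a positive linear form -/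

section SosLinear

variable {ι : Type*} [Fintype ι]

/-- The polynomials `∑_k (⟨A_k, X⟩ + β_k)² + ⟨c, X⟩ + d` with `c > 0` and `d ≥ 0`, where `d > 0` if
there are no variables. The squared forms are affine and not only linear so that the class is closed
under substituting positive constants for some of the variables. -/
def IsSosLinear (P : MvPolynomial ι ℝ) : Prop :=
  ∃ (r : ℕ) (A : Fin r → ι → ℝ) (β : Fin r → ℝ) (c : ι → ℝ) (d : ℝ),
    (∀ n, 0 < c n) ∧ 0 ≤ d ∧ (0 < d ∨ Nonempty ι) ∧
    P = ∑ k, (∑ n, C (A k n) * X n + C (β k)) ^ 2 + ∑ n, C (c n) * X n + C d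

/-- The growth properties of a polynomial on the orthant on which the analytic continuation rests,
with a single constant `κ`: the polynomial lies between `|x|` and `|x|²` up to `κ`, and it is
quadratic in each variable with a derivative at most of the size of its square root. -/
structure GrowthBounds (κ : ℝ) (P : MvPolynomial ι ℝ) : Prop where
  one_le : 1 ≤ κ
  lower : ∀ x ∈ orthant ι, 1 + ∑ n, x n ≤ κ * eval x P
  upper : ∀ x ∈ orthant ι, eval x P ≤ κ * (1 + ∑ n, x n) ^ 2
  line : ∀ [DecidableEq ι], ∀ x ∈ orthant ι, ∀ i, ∃ A B : ℝ, |A| ≤ κ ∧ |B| ≤ κ * √(eval x P) ∧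
    ∀ y : ℝ, eval (x + Pi.single i y) P = eval x P + B * y + A * y ^ 2

theorem eval_sosLinear {r : ℕ} (A : Fin r → ι → ℝ) (β : Fin r → ℝ) (c : ι → ℝ) (d : ℝ)
    (x : ι → ℝ) :
    eval x (∑ k, (∑ n, C (A k n) * X n + C (β k)) ^ 2 + ∑ n, C (c n) * X n + C d) =
      ∑ k, (∑ n, A k n * x n + β k) ^ 2 + ∑ n, c n * x n + d := by
  simp

theorem sum_nonneg_of_mem_orthant {x : ι → ℝ} (hx : x ∈ orthant ι) : 0 ≤ ∑ n, x n :=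
  Finset.sum_nonneg fun n _ => zero_le_one.trans (hx n)

theorem exists_pos_forall_le_of_pos {c : ι → ℝ} (hc : ∀ n, 0 < c n) :
    ∃ ε > 0, ∀ n, ε ≤ c n := by
  have : ∀ᶠ ε in 𝓝[>] (0 : ℝ), ∀ n, ε ≤ c n :=
    eventually_all.2 fun n => mem_of_superset (Ioc_mem_nhdsGT (hc n)) fun _ h => h.2
  obtain ⟨ε, h1, h2⟩ := (this.and self_mem_nhdsWithin).exists
  exact ⟨ε, h2, h1⟩

namespace IsSosLinear

variable {P : MvPolynomial ι ℝ}

theorem exists_lower (hP : IsSosLinear P) :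
    ∃ ε > 0, ∀ x ∈ orthant ι, ε * (1 + ∑ n, x n) ≤ eval x P := by
  obtain ⟨r, A, β, c, d, hc, hd, hd', rfl⟩ := hP
  obtain ⟨ε, hε, hεc⟩ := exists_pos_forall_le_of_pos hc
  have hlin : ∀ x ∈ orthant ι, ε * ∑ n, x n ≤ ∑ n, c n * x n := fun x hx => by
    rw [Finset.mul_sum]
    exact Finset.sum_le_sum fun n _ =>
      mul_le_mul_of_nonneg_right (hεc n) (zero_le_one.trans (hx n))
  have hsq : ∀ x : ι → ℝ, 0 ≤ ∑ k, (∑ n, A k n * x n + β k) ^ 2 := fun x =>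
    Finset.sum_nonneg fun k _ => sq_nonneg _
  rcases hd' with hd' | hι
  · refine ⟨min ε d, lt_min hε hd', fun x hx => ?_⟩
    rw [eval_sosLinear]
    have h0 := sum_nonneg_of_mem_orthant hx
    have h1 := hlin x hx
    have h2 := hsq x
    have h3 := mul_le_mul_of_nonneg_right (min_le_left ε d) h0
    have h4 := min_le_right ε d
    linarith
  · refine ⟨ε / 2, by positivity, fun x hx => ?_⟩
    rw [eval_sosLinear]
    have h0 : 1 ≤ ∑ n, x n := (hx (Classical.arbitrary ι)).trans
      (Finset.single_le_sum (fun n _ => zero_le_one.trans (hx n)) (Finset.mem_univ _))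
    have h1 := hlin x hx
    have h2 := hsq x
    nlinarith

theorem exists_upper (hP : IsSosLinear P) :
    ∃ κ, ∀ x ∈ orthant ι, eval x P ≤ κ * (1 + ∑ n, x n) ^ 2 := by
  obtain ⟨r, A, β, c, d, hc, hd, hd', rfl⟩ := hP
  refine ⟨∑ k, (∑ n, |A k n| + |β k|) ^ 2 + ∑ n, c n + d, fun x hx => ?_⟩
  rw [eval_sosLinear, add_mul, add_mul]
  set S := 1 + ∑ n, x n with hS
  have hS1 : 1 ≤ S := by linarith [sum_nonneg_of_mem_orthant hx]
  have hxS : ∀ n, |x n| ≤ S := fun n => by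
    rw [abs_of_nonneg (zero_le_one.trans (hx n))]
    have := Finset.single_le_sum (fun n _ => zero_le_one.trans (hx n)) (Finset.mem_univ n)
    linarith
  have hS2 : S ≤ S ^ 2 := le_self_pow₀ hS1 two_ne_zero
  refine add_le_add (add_le_add ?_ ?_) (le_mul_of_one_le_right hd (one_le_pow₀ hS1))
  · rw [Finset.sum_mul]
    refine Finset.sum_le_sum fun k _ => ?_
    rw [← mul_pow, ← sq_abs]
    refine pow_le_pow_left₀ (abs_nonneg _) ?_ 2
    rw [add_mul, Finset.sum_mul]
    refine (abs_add_le _ _).trans (add_le_add ?_ (le_mul_of_one_le_right (abs_nonneg _) hS1))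
    refine (Finset.abs_sum_le_sum_abs _ _).trans (Finset.sum_le_sum fun n _ => ?_)
    rw [abs_mul]
    exact mul_le_mul_of_nonneg_left (hxS n) (abs_nonneg _)
  · rw [Finset.sum_mul]
    exact Finset.sum_le_sum fun n _ =>
      mul_le_mul_of_nonneg_left (((le_abs_self _).trans (hxS n)).trans hS2) (hc n).le

/-- Each affine form is bounded by the square root of the polynomial, hence so is the derivative. -/
theorem exists_line [DecidableEq ι] (hP : IsSosLinear P) :
    ∃ κ, ∀ i, ∃ (A : ℝ) (B : (ι → ℝ) → ℝ), |A| ≤ κ ∧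
      (∀ x ∈ orthant ι, |B x| ≤ κ * √(eval x P)) ∧
      (∀ x y, eval (x + Pi.single i y) P = eval x P + B x * y + A * y ^ 2) ∧
      (∀ x, eval x (pderiv i P) = B x) ∧ ∀ j, ∃ e, pderiv j (pderiv i P) = C e := by
  obtain ⟨ε, hε, hlow⟩ := hP.exists_lower
  obtain ⟨r, A, β, c, d, hc, hd, hd', hPe⟩ := hP
  have hB : ∀ i, ∀ x ∈ orthant ι,
      |∑ k, 2 * A k i * (∑ n, A k n * x n + β k) + c i| ≤
        (∑ k, 2 * |A k i| + c i / √ε) * √(eval x P) := by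
    intro i x hx
    have hlowx := hlow x hx
    rw [hPe, eval_sosLinear] at hlowx ⊢
    set p := ∑ k, (∑ n, A k n * x n + β k) ^ 2 + ∑ n, c n * x n + d with hp
    rw [add_mul, Finset.sum_mul]
    refine (abs_add_le _ _).trans (add_le_add ?_ ?_)
    · refine (Finset.abs_sum_le_sum_abs _ _).trans (Finset.sum_le_sum fun k _ => ?_)
      rw [abs_mul, abs_mul, abs_two]
      refine mul_le_mul_of_nonneg_left ?_ (by positivity)
      refine Real.abs_le_sqrt ?_
      have h1 := Finset.single_le_sum (f := fun k => (∑ n, A k n * x n + β k) ^ 2)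
        (fun k _ => sq_nonneg _) (Finset.mem_univ k)
      have h2 : 0 ≤ ∑ n, c n * x n := Finset.sum_nonneg fun n _ =>
        mul_nonneg (hc n).le (zero_le_one.trans (hx n))
      linarith
    · rw [abs_of_pos (hc i), div_mul_eq_mul_div, le_div_iff₀ (Real.sqrt_pos.mpr hε)]
      refine mul_le_mul_of_nonneg_left (Real.sqrt_le_sqrt ?_) (hc i).le
      have := sum_nonneg_of_mem_orthant hx
      nlinarith
  have hlin : ∀ (a : ι → ℝ) (j : ι), pderiv j (∑ n, C (a n) * X n) = C (a j) := by
    intro a j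
    simp only [map_sum, pderiv_C_mul, pderiv_X, Pi.single_apply, mul_ite, mul_one, mul_zero,
      Finset.sum_ite_eq', Finset.mem_univ, if_true]
  have hpd : ∀ i, pderiv i P =
      ∑ k, C (2 * A k i) * (∑ n, C (A k n) * X n + C (β k)) + C (c i) := by
    intro i
    rw [hPe]
    simp only [map_add, map_sum (pderiv i) _ (Finset.univ : Finset (Fin r)), hlin, pderiv_C,
      Derivation.leibniz_pow, add_zero]
    congr 1
    refine Finset.sum_congr rfl fun k _ => ?_
    rw [C_mul, nsmul_eq_mul, smul_eq_mul, pow_one, show (C 2 : MvPolynomial ι ℝ) = 2 from rfl]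
    push_cast
    ring
  refine ⟨∑ i, (∑ k, 2 * |A k i| + c i / √ε + ∑ k, A k i ^ 2), fun i =>
    ⟨∑ k, A k i ^ 2, fun x => ∑ k, 2 * A k i * (∑ n, A k n * x n + β k) + c i, ?_, ?_, ?_, ?_, ?_⟩⟩
  · have h0 : ∀ i, 0 ≤ ∑ k, 2 * |A k i| + c i / √ε := fun i =>
      add_nonneg (Finset.sum_nonneg fun k _ => by positivity)
        (div_nonneg (hc i).le (Real.sqrt_nonneg _))
    have h1 : ∀ i, 0 ≤ ∑ k, A k i ^ 2 := fun i => Finset.sum_nonneg fun k _ => sq_nonneg _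
    rw [abs_of_nonneg (h1 i)]
    refine le_trans ?_ (Finset.single_le_sum (fun i _ => add_nonneg (h0 i) (h1 i))
      (Finset.mem_univ i))
    linarith [h0 i]
  · intro x hx
    refine (hB i x hx).trans (mul_le_mul_of_nonneg_right ?_ (Real.sqrt_nonneg _))
    have h0 : ∀ i, 0 ≤ ∑ k, 2 * |A k i| + c i / √ε := fun i =>
      add_nonneg (Finset.sum_nonneg fun k _ => by positivity)
        (div_nonneg (hc i).le (Real.sqrt_nonneg _))
    have h1 : ∀ i, 0 ≤ ∑ k, A k i ^ 2 := fun i => Finset.sum_nonneg fun k _ => sq_nonneg _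
    refine le_trans ?_ (Finset.single_le_sum (fun i _ => add_nonneg (h0 i) (h1 i))
      (Finset.mem_univ i))
    linarith [h1 i]
  · intro x y
    have hs : ∀ a : ι → ℝ, ∑ n, a n * (x + Pi.single i y : ι → ℝ) n = ∑ n, a n * x n + a i * y :=
      fun a => by simp [mul_add, Finset.sum_add_distrib, Pi.single_apply]
    rw [hPe, eval_sosLinear, eval_sosLinear]
    simp only [hs]
    have : ∑ k, (∑ n, A k n * x n + A k i * y + β k) ^ 2 =
        ∑ k, (∑ n, A k n * x n + β k) ^ 2 +
          (∑ k, 2 * A k i * (∑ n, A k n * x n + β k)) * y + (∑ k, A k i ^ 2) * y ^ 2 := by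
      rw [Finset.sum_mul, Finset.sum_mul, ← Finset.sum_add_distrib, ← Finset.sum_add_distrib]
      exact Finset.sum_congr rfl fun k _ => by ring
    rw [this]
    ring
  · intro x
    rw [hpd]
    simp
  · intro j
    refine ⟨∑ k, 2 * A k i * A k j, ?_⟩
    rw [hpd, map_add, pderiv_C, add_zero, map_sum, map_sum]
    refine Finset.sum_congr rfl fun k _ => ?_
    rw [pderiv_C_mul, map_add, hlin, pderiv_C, add_zero, ← C_mul]

theorem growthBounds (hP : IsSosLinear P) : ∀ᶠ κ in atTop, GrowthBounds κ P := by
  obtain ⟨ε, hε, hlow⟩ := hP.exists_lower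
  obtain ⟨κ₁, hup⟩ := hP.exists_upper
  classical
  obtain ⟨κ₂, hline⟩ := hP.exists_line
  filter_upwards [eventually_ge_atTop 1, eventually_ge_atTop ε⁻¹, eventually_ge_atTop κ₁,
    eventually_ge_atTop κ₂] with κ h1 hκε hκ₁ hκ₂
  refine ⟨h1, fun x hx => ?_, fun x hx => ?_, fun x hx i => ?_⟩
  · have h0 : 0 ≤ eval x P := le_trans
      (mul_nonneg hε.le (by linarith [sum_nonneg_of_mem_orthant hx])) (hlow x hx)
    refine le_trans ?_ (mul_le_mul_of_nonneg_right hκε h0)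
    rw [← div_eq_inv_mul, le_div_iff₀ hε, mul_comm]
    exact hlow x hx
  · exact (hup x hx).trans (mul_le_mul_of_nonneg_right hκ₁ (sq_nonneg _))
  · obtain ⟨A, B, hA, hB, hl, -⟩ := hline i
    refine ⟨A, B x, hA.trans hκ₂,
      (hB x hx).trans (mul_le_mul_of_nonneg_right hκ₂ (Real.sqrt_nonneg _)), fun y => ?_⟩
    convert! hl x y

theorem eval_pos (hP : IsSosLinear P) {x : ι → ℝ} (hx : x ∈ orthant ι) : 0 < eval x P := by
  obtain ⟨ε, hε, hlow⟩ := hP.exists_lower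
  have := sum_nonneg_of_mem_orthant hx
  exact (mul_pos hε (by linarith)).trans_le (hlow x hx)

/-- The iterated derivatives of order at least two are constant. -/
theorem foldr_pderiv (hP : IsSosLinear P) (s : Multiset ι) :
    (s.card = 1 → ∃ i, s.foldr (fun n p => pderiv n p) P = pderiv i P) ∧
      (2 ≤ s.card → ∃ e, s.foldr (fun n p => pderiv n p) P = C e) := by
  classical
  obtain ⟨κ, hline⟩ := hP.exists_line
  induction s using Multiset.induction_on with
  | empty => simp
  | cons i s ih =>
    rw [Multiset.foldr_cons, Multiset.card_cons]
    refine ⟨fun h => ⟨i, ?_⟩, fun h => ?_⟩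
    · rw [Multiset.card_eq_zero.mp (Nat.succ_injective h), Multiset.foldr_zero]
    · rcases (show 1 ≤ s.card by omega).eq_or_lt with h1 | h1
      · obtain ⟨j, hj⟩ := ih.1 h1.symm
        rw [hj]
        obtain ⟨-, -, -, -, -, -, h⟩ := hline j
        exact h i
      · obtain ⟨e, he⟩ := ih.2 h1
        exact ⟨0, by rw [he, pderiv_C, C_0]⟩

/-- Every derivative of positive order is at most of the size of the square root of the
polynomial. -/
theorem hypoelliptic (hP : IsSosLinear P) : Hypoelliptic P := by
  classical
  refine ⟨fun x hx => hP.eval_pos hx, fun α hα => ?_⟩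
  obtain ⟨ε, hε, hlow⟩ := hP.exists_lower
  have hsqrt : ∀ x ∈ orthant ι, √ε * √(∑ n, |x n|) ≤ √(eval x P) := by
    intro x hx
    rw [← Real.sqrt_mul hε.le]
    refine Real.sqrt_le_sqrt (le_trans ?_ (hlow x hx))
    rw [Finset.sum_congr rfl fun n _ => abs_of_nonneg (zero_le_one.trans (hx n))]
    exact mul_le_mul_of_nonneg_left (by linarith) hε.le
  obtain ⟨κ, hκ⟩ : ∃ κ, ∀ x ∈ orthant ι, |eval x (multiDeriv α P)| ≤ κ * √(eval x P) := by
    have hcard : (Finsupp.toMultiset α).card ≠ 0 := by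
      rw [Ne, Multiset.card_eq_zero]
      exact fun h => hα (by rw [← Finsupp.toMultiset_toFinsupp α, h, map_zero])
    unfold multiDeriv
    rcases (show 1 ≤ (Finsupp.toMultiset α).card by omega).eq_or_lt with h1 | h1
    · obtain ⟨i, hi⟩ := (hP.foldr_pderiv _).1 h1.symm
      obtain ⟨κ, hline⟩ := hP.exists_line
      obtain ⟨-, B, -, hB, -, hd, -⟩ := hline i
      exact ⟨κ, fun x hx => by rw [hi, hd]; exact hB x hx⟩
    · obtain ⟨e, he⟩ := (hP.foldr_pderiv _).2 h1
      refine ⟨|e| / √ε, fun x hx => ?_⟩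
      rw [he, eval_C, div_mul_eq_mul_div, le_div_iff₀ (Real.sqrt_pos.mpr hε)]
      refine mul_le_mul_of_nonneg_left (Real.sqrt_le_sqrt ?_) (abs_nonneg _)
      have h1 := hlow x hx
      have := sum_nonneg_of_mem_orthant hx
      nlinarith
  have hκ0 : ∀ x ∈ orthant ι, |eval x (multiDeriv α P) / eval x P| ≤
      |κ| / (√ε * √(∑ n, |x n|)) ∨ ∑ n, |x n| = 0 := by
    intro x hx
    by_cases h0 : ∑ n, |x n| = 0
    · exact Or.inr h0
    left
    have hS : 0 < ∑ n, |x n| := lt_of_le_of_ne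
      (Finset.sum_nonneg fun n _ => abs_nonneg _) (Ne.symm h0)
    have hp := hP.eval_pos hx
    have hsp : 0 < √(eval x P) := Real.sqrt_pos.mpr hp
    rw [abs_div, abs_of_pos hp]
    calc |eval x (multiDeriv α P)| / eval x P ≤ |κ| * √(eval x P) / eval x P := by
          gcongr
          exact (hκ x hx).trans (mul_le_mul_of_nonneg_right (le_abs_self κ) hsp.le)
      _ = |κ| / √(eval x P) := by
          nth_rewrite 2 [← Real.mul_self_sqrt hp.le]
          field_simp
      _ ≤ _ := by
          have : 0 < √ε * √(∑ n, |x n|) := by positivity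
          gcongr
          exact hsqrt x hx
  have hlim : Tendsto (fun x : ι → ℝ => |κ| / (√ε * √(∑ n, |x n|))) (orthantAtTop ι) (𝓝 0) := by
    refine Tendsto.const_div_atTop ?_ _
    refine Tendsto.const_mul_atTop (Real.sqrt_pos.mpr hε) ?_
    exact Real.tendsto_sqrt_atTop.comp (tendsto_comap.mono_left inf_le_left)
  refine squeeze_zero_norm' ?_ hlim
  have h1 : ∀ᶠ x in orthantAtTop ι, x ∈ orthant ι := mem_inf_of_right (mem_principal_self _)
  have h2 : ∀ᶠ x in orthantAtTop ι, 0 < ∑ n, |x n| :=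
    (tendsto_comap.mono_left inf_le_left : Tendsto (fun x : ι → ℝ => ∑ n, |x n|)
      (orthantAtTop ι) atTop).eventually_gt_atTop 0
  filter_upwards [h1, h2] with x hx hx'
  exact (hκ0 x hx).resolve_right hx'.ne'

end IsSosLinear

end SosLinear

/-! ### The terms of the series along lines in the coordinate directions -/

theorem add_one_mem_orthant {ι : Type*} (k : ι →₀ ℕ) : (fun n => (k n : ℝ) + 1) ∈ orthant ι :=
  fun n => by simp

section Lines

variable {ι : Type*} [Fintype ι]

theorem norm_cpow_neg_le {z s : ℂ} {X : ℝ} {B : ℕ} (hz : z ≠ 0) (hX : 1 ≤ X) (h1 : ‖z‖ ≤ X)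
    (h2 : ‖z‖⁻¹ ≤ X) (hs : ‖s‖ ≤ B) : ‖z ^ (-s)‖ ≤ Real.exp (Real.pi * B) * X ^ B := by
  have hz0 : 0 < ‖z‖ := norm_pos_iff.mpr hz
  have hre : |s.re| ≤ B := (Complex.abs_re_le_norm s).trans hs
  have him : |s.im| ≤ B := (Complex.abs_im_le_norm s).trans hs
  have hpow : ‖z‖ ^ (-s).re ≤ X ^ B := by
    rw [← Real.rpow_natCast, Complex.neg_re]
    rcases le_total 0 s.re with h | h
    · rw [Real.rpow_neg hz0.le, ← Real.inv_rpow hz0.le]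
      calc ‖z‖⁻¹ ^ s.re ≤ X ^ s.re := Real.rpow_le_rpow (by positivity) h2 h
        _ ≤ X ^ (B : ℝ) := Real.rpow_le_rpow_of_exponent_le hX ((le_abs_self _).trans hre)
    · calc ‖z‖ ^ (-s.re) ≤ X ^ (-s.re) := Real.rpow_le_rpow (by positivity) h1 (by linarith)
        _ ≤ X ^ (B : ℝ) := Real.rpow_le_rpow_of_exponent_le hX ((neg_le_abs _).trans hre)
  have hexp : (Real.exp (Complex.arg z * (-s).im))⁻¹ ≤ Real.exp (Real.pi * B) := by
    rw [← Real.exp_neg, Real.exp_le_exp]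
    calc -(Complex.arg z * (-s).im) ≤ |Complex.arg z| * |s.im| := by
          rw [Complex.neg_im, mul_neg, neg_neg, ← abs_mul]
          exact le_abs_self _
      _ ≤ Real.pi * B := mul_le_mul (Complex.abs_arg_le_pi z) him (abs_nonneg _) Real.pi_pos.le
  calc ‖z ^ (-s)‖ ≤ ‖z‖ ^ (-s).re / Real.exp (Complex.arg z * (-s).im) := Complex.norm_cpow_le _ _
    _ ≤ X ^ B * Real.exp (Real.pi * B) := by
      rw [div_eq_mul_inv]
      gcongr
    _ = _ := mul_comm _ _

/-- On a disc of radius comparable to `√|x|`, moving one coordinate by a complex number changes the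
value of the polynomial by at most half
of that value. -/
theorem GrowthBounds.exists_quadratic [DecidableEq ι] {κ : ℝ} {P : MvPolynomial ι ℝ}
    (hP : GrowthBounds κ P) {x : ι → ℝ} (hx : x ∈ orthant ι) (i : ι) :
    ∃ A B : ℝ, (∀ y : ℝ, eval (x + Pi.single i y) P = eval x P + B * y + A * y ^ 2) ∧
      ∀ z : ℂ, ‖z‖ ≤ √(1 + ∑ n, x n) / (4 * κ ^ 2) → ‖B * z + A * z ^ 2‖ ≤ eval x P / 2 := by
  obtain ⟨A, B, hA, hB, hl⟩ := hP.line x hx i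
  refine ⟨A, B, hl, fun z hz => ?_⟩
  have hκ := hP.one_le
  have hlow := hP.lower x hx
  have hS := sum_nonneg_of_mem_orthant hx
  set S := 1 + ∑ n, x n with hSdef
  have hS1 : 1 ≤ S := by linarith
  set p := eval x P with hp
  have hp0 : 0 < p := by
    by_contra h
    nlinarith
  have hsS : √S ≤ κ * √p := by
    refine Real.sqrt_le_iff.mpr ⟨by positivity, ?_⟩
    rw [mul_pow, Real.sq_sqrt hp0.le]
    nlinarith [mul_nonneg (sub_nonneg.mpr hκ) hp0.le]
  have hz' : 4 * κ * ‖z‖ ≤ √p := by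
    rw [le_div_iff₀ (by positivity)] at hz
    have : κ * (4 * κ * ‖z‖) ≤ κ * √p := by nlinarith
    exact le_of_mul_le_mul_left this (by linarith)
  have hpsq : √p * √p = p := Real.mul_self_sqrt hp0.le
  have hsp := Real.sqrt_nonneg p
  have hz0 := norm_nonneg z
  calc ‖(B : ℂ) * z + A * z ^ 2‖ ≤ |B| * ‖z‖ + |A| * ‖z‖ ^ 2 := by
        refine (norm_add_le _ _).trans_eq ?_
        simp
    _ ≤ κ * √p * ‖z‖ + κ * ‖z‖ ^ 2 := by gcongr
    _ ≤ p / 4 + p / 4 := by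
      refine add_le_add ?_ ?_
      · nlinarith
      · have h1 : (4 * κ * ‖z‖) * (4 * κ * ‖z‖) ≤ √p * √p :=
          mul_le_mul hz' hz' (by positivity) hsp
        have h2 : κ * ‖z‖ ^ 2 ≤ κ * (κ * ‖z‖ ^ 2) :=
          le_mul_of_one_le_left (by positivity) hκ
        nlinarith [sq_nonneg (κ * ‖z‖)]
    _ = p / 2 := by ring

variable {T : ℕ}

/-- The holomorphic interpolation of the terms of the series along a line. -/
theorem exists_holomorphic_interpolation [DecidableEq ι] {κ : ℝ} {P : Fin T → MvPolynomial ι ℝ}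
    (hP : ∀ t, GrowthBounds κ (P t)) (hκ : 1 ≤ κ) {x : ι → ℝ} (hx : x ∈ orthant ι) (i : ι)
    {s : Fin T → ℂ} {B : ℕ} (hs : ‖s‖ ≤ B) :
    ∃ h : ℂ → ℂ, (∀ y : ℝ, h y = ∏ t, ((eval (x + Pi.single i y) (P t) : ℝ) : ℂ) ^ (-s t)) ∧
      (∀ z ∈ Metric.ball (0 : ℂ) (√(1 + ∑ n, x n) / (4 * κ ^ 2)), DifferentiableAt ℂ h z) ∧
      ∀ z ∈ Metric.ball (0 : ℂ) (√(1 + ∑ n, x n) / (4 * κ ^ 2)),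
        ‖h z‖ ≤ (Real.exp (Real.pi * B) * (2 * κ * (1 + ∑ n, x n) ^ 2) ^ B) ^ T := by
  choose A B' hl hz using fun t => (hP t).exists_quadratic hx i
  have hS := sum_nonneg_of_mem_orthant hx
  have hup := fun t => (hP t).upper x hx
  have hlow := fun t => (hP t).lower x hx
  set S := 1 + ∑ n, x n with hSdef
  have hS1 : 1 ≤ S := by linarith
  have hp0 : ∀ t, 0 < eval x (P t) := fun t => by
    have := hlow t
    by_contra h
    nlinarith
  let q : Fin T → ℂ → ℂ := fun t z => (eval x (P t) : ℝ) + (B' t * z + A t * z ^ 2)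
  have hre : ∀ t, ∀ z ∈ Metric.ball (0 : ℂ) (√S / (4 * κ ^ 2)), eval x (P t) / 2 ≤ (q t z).re := by
    intro t z hzm
    have h1 := hz t z (mem_ball_zero_iff.mp hzm).le
    have h2 := (abs_le.mp ((Complex.abs_re_le_norm _).trans h1)).1
    simp only [q, Complex.add_re, Complex.ofReal_re] at h2 ⊢
    linarith
  refine ⟨fun z => ∏ t, q t z ^ (-s t), fun y => ?_, fun z hzm => ?_, fun z hzm => ?_⟩
  · refine Finset.prod_congr rfl fun t _ => ?_
    rw [hl t y]
    simp only [q]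
    push_cast
    rw [add_assoc]
  · refine DifferentiableAt.fun_finsetProd fun t _ => ?_
    refine DifferentiableAt.cpow ?_ (differentiableAt_const _) ?_
    · fun_prop
    · exact Or.inl (lt_of_lt_of_le (half_pos (hp0 t)) (hre t z hzm))
  · rw [norm_prod]
    refine (Finset.prod_le_prod (fun t _ => norm_nonneg _) fun t _ => ?_).trans_eq
      (by rw [Finset.prod_const, Finset.card_univ, Fintype.card_fin])
    have hqre := hre t z hzm
    have hqlow : eval x (P t) / 2 ≤ ‖q t z‖ := hqre.trans (Complex.re_le_norm _)
    have hq0 : 0 < ‖q t z‖ := (half_pos (hp0 t)).trans_le hqlow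
    have hqup : ‖q t z‖ ≤ 2 * eval x (P t) := by
      refine (norm_add_le _ _).trans ?_
      rw [Complex.norm_real, Real.norm_of_nonneg (hp0 t).le]
      linarith [hz t z (mem_ball_zero_iff.mp hzm).le, hp0 t]
    have hS2 : 1 ≤ S ^ 2 := one_le_pow₀ hS1
    refine norm_cpow_neg_le (norm_pos_iff.mp hq0) ?_ ?_ ?_ ((norm_le_pi_norm s t).trans hs)
    · nlinarith
    · linarith [hup t]
    · rw [inv_le_comm₀ hq0 (by positivity)]
      refine le_trans ?_ hqlow
      rw [inv_le_iff_one_le_mul₀ (by positivity)]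
      have h1 : 1 ≤ κ * eval x (P t) := hS1.trans (hlow t)
      have : 0 ≤ κ * eval x (P t) := by linarith
      nlinarith

/-- The power series whose coefficients are the terms of the zeta series: the point `m ≥ 1`
corresponds to the exponent `m - 1`. -/
def zetaSeries (P : Fin T → MvPolynomial ι ℝ) (μ : ι → ℂ) (s : Fin T → ℂ) : MvPowerSeries ι ℂ :=
  fun k => zetaTerm 1 P μ s fun n => k n + 1

theorem coeff_zetaSeries (P : Fin T → MvPolynomial ι ℝ) (μ : ι → ℂ) (s : Fin T → ℂ)
    (k : ι →₀ ℕ) : MvPowerSeries.coeff k (zetaSeries P μ s) =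
      (∏ n, μ n ^ (k n + 1)) *
        ∏ t, ((eval (fun n => ((k n : ℝ) + 1)) (P t) : ℝ) : ℂ) ^ (-s t) := by
  change zetaTerm 1 P μ s (fun n => k n + 1) = _
  simp [zetaTerm]

theorem one_add_apply_le (k : ι →₀ ℕ) (i : ι) : 1 + (k i : ℝ) ≤ 1 + ∑ n, ((k n : ℝ) + 1) := by
  have := Finset.single_le_sum (f := fun n => (k n : ℝ) + 1) (fun n _ => by positivity)
    (Finset.mem_univ i)
  linarith

/-- A difference of high order in the `i`-th direction makes the terms of the series decay as fast
as desired in this direction, uniformly for bounded `s`: each difference gains a factor of the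
size of `|x|^{-1/2}`, by Cauchy's estimate on a disc of radius comparable to `√|x|`. -/
theorem decaysIn_zetaSeries {P : Fin T → MvPolynomial ι ℝ} (hP : ∀ t, IsSosLinear (P t))
    {μ : ι → ℂ} (hμ : ∀ i, ‖μ i‖ = 1) (B D : ℕ) :
    ∃ (K M : ℕ) (C : ℝ), 0 ≤ C ∧ ∀ s : Fin T → ℂ, ‖s‖ ≤ B → ∀ i, DecaysIn i C M D
      ((1 - MvPowerSeries.C (μ i) * MvPowerSeries.X i) ^ K * zetaSeries P μ s) := by
  classical
  obtain ⟨κ, hκP, hκ⟩ : ∃ κ, (∀ t, GrowthBounds κ (P t)) ∧ 1 ≤ κ :=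
    ((eventually_all.2 fun t => (hP t).growthBounds).and (eventually_ge_atTop 1)).exists
  -- `|x| ^ (2 B T)` bounds the terms, and `2 J` differences gain `|x| ^ J`
  obtain ⟨J, hJ⟩ : ∃ J, J = 2 * B * T + D := ⟨_, rfl⟩
  obtain ⟨L, hL⟩ : ∃ L : ℝ, L = 16 * κ ^ 2 * (2 * J + 1) := ⟨_, rfl⟩
  have hL0 : 0 < L := by rw [hL]; positivity
  obtain ⟨E, hE⟩ : ∃ E : ℝ, E = (Real.exp (Real.pi * B) * (2 * κ) ^ B) ^ T := ⟨_, rfl⟩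
  have hE0 : 0 ≤ E := by rw [hE]; positivity
  refine ⟨2 * J, max (2 * J) ⌈L ^ 2⌉₊, E * L ^ (2 * J), by positivity, fun s hs i k hk => ?_⟩
  obtain ⟨n, hn⟩ : ∃ n, k i = n + 2 * J := ⟨k i - 2 * J, by
    have := (le_max_left _ _).trans hk
    omega⟩
  set x : ι → ℝ := fun l => (k l : ℝ) + 1 with hx
  have hxo : x ∈ orthant ι := add_one_mem_orthant k
  obtain ⟨h, hh, hd, hb⟩ := exists_holomorphic_interpolation hκP hκ hxo i hs
  have hkS : 1 + (k i : ℝ) ≤ 1 + ∑ l, x l := one_add_apply_le k i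
  set S := 1 + ∑ l, x l with hS
  have hS0 : 0 < S := by
    have : (0 : ℝ) ≤ k i := Nat.cast_nonneg _
    linarith
  have hLS : L ≤ √S := by
    refine Real.le_sqrt_of_sq_le (le_trans ?_ hkS)
    have h1 : L ^ 2 ≤ (⌈L ^ 2⌉₊ : ℝ) := Nat.le_ceil _
    have h2 : ((⌈L ^ 2⌉₊ : ℕ) : ℝ) ≤ (k i : ℝ) := by exact_mod_cast (le_max_right _ _).trans hk
    linarith
  -- `L` is such that `2 J` steps of length `√S / L` stay in the disc of radius `√S / (4 κ²)`
  have hdiff := norm_iterate_backwardDiff_le (r := √S / L) ((one_le_div hL0).mpr hLS) (2 * J)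
    (by
      have hs0 : 0 < √S := Real.sqrt_pos.mpr hS0
      rw [hL, mul_div_assoc', div_lt_div_iff₀ (by positivity) (by positivity)]
      push_cast
      have : 0 < √S * κ ^ 2 := by positivity
      have hJ0 : (0 : ℝ) ≤ J := Nat.cast_nonneg _
      nlinarith [mul_nonneg this.le hJ0]) hd hb
  have hbase : k = Finsupp.single i (n + 2 * J) + k.erase i := by
    rw [← hn, Finsupp.single_add_erase]
  have hcoeff := coeff_one_sub_pow_mul i (μ i) (∏ l, μ l ^ (k.erase i l + 1))
    (-((n + 2 * J : ℕ) : ℂ)) (zetaSeries P μ s) (k.erase i) h (fun n' => ?_) (2 * J) n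
  · rw [← hbase, add_neg_cancel] at hcoeff
    rw [hcoeff, norm_mul, norm_mul, norm_prod, norm_pow, hμ, one_pow, mul_one]
    simp only [norm_pow, hμ, one_pow, Finset.prod_const_one, one_mul]
    refine hdiff.trans ?_
    have hSD : E * L ^ (2 * J) / S ^ D ≤ E * L ^ (2 * J) / (1 + (k i : ℝ)) ^ D := by gcongr
    refine le_trans (le_of_eq ?_) hSD
    rw [div_pow, pow_mul (√S), Real.sq_sqrt hS0.le, mul_pow (2 * κ), ← mul_assoc, mul_pow, ← hE,
      ← pow_mul, ← pow_mul, div_div_eq_mul_div, hJ, pow_add S]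
    have : S ^ (2 * B * T) ≠ 0 := (pow_pos hS0 _).ne'
    field_simp
    ring
  · have hpt : (fun l => (((Finsupp.single i n' + k.erase i) l : ℕ) : ℝ) + 1) =
        x + Pi.single i ((n' : ℝ) - ((n + 2 * J : ℕ) : ℝ)) := by
      funext l
      by_cases hl : l = i
      · subst hl
        simp only [Finsupp.add_apply, Finsupp.single_eq_same, Finsupp.erase_same, Pi.add_apply,
          Pi.single_eq_same, hx]
        rw [hn]
        push_cast
        ring
      · simp [hx, hl]
    have hc : (n' : ℂ) + -((n + 2 * J : ℕ) : ℂ) =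
        (((n' : ℝ) - ((n + 2 * J : ℕ) : ℝ) : ℝ) : ℂ) := by
      push_cast
      ring
    rw [coeff_zetaSeries, hpt, hc, hh]
    congr 1
    simp only [Finsupp.add_apply, add_assoc, pow_add _ (Finsupp.single i n' _)]
    rw [Finset.prod_mul_distrib, mul_comm]
    congr 1
    rw [Finset.prod_eq_single i (fun l _ hl => by simp [hl]) (by simp)]
    simp

end Lines

/-! ### Analytic continuation -/

section Continuation

variable {ι : Type*} [Fintype ι] {T : ℕ}

theorem summable_prod_inv_sq : Summable fun k : ι →₀ ℕ => ∏ l, ((1 + (k l : ℝ)) ^ 2)⁻¹ := by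
  refine summable_prod_apply (g := fun _ n => ((1 + (n : ℝ)) ^ 2)⁻¹) (fun _ n => by positivity)
    fun _ => ?_
  have h := (summable_nat_add_iff 1).mpr (Real.summable_nat_pow_inv.mpr one_lt_two)
  simpa [add_comm] using h

theorem inv_pow_le_prod_inv_sq {k : ι →₀ ℕ} {S : ℝ} (h : ∀ l, 1 + (k l : ℝ) ≤ S) :
    (S ^ (2 * Fintype.card ι))⁻¹ ≤ ∏ l, ((1 + (k l : ℝ)) ^ 2)⁻¹ := by
  rw [Finset.prod_inv_distrib]
  refine inv_anti₀ (Finset.prod_pos fun l _ => by positivity) ?_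
  calc ∏ l, (1 + (k l : ℝ)) ^ 2 ≤ ∏ _l : ι, S ^ 2 :=
        Finset.prod_le_prod (fun l _ => by positivity)
          fun l _ => pow_le_pow_left₀ (by positivity) (h l) 2
    _ = _ := by rw [Finset.prod_const, Finset.card_univ, pow_mul]

/-- The coefficients of the regularized series have a summable majorant, uniform for bounded `s`:
outside a finite set, the difference in the direction of the largest coordinate makes the term
small enough. -/
theorem exists_majorant {P : Fin T → MvPolynomial ι ℝ} (hP : ∀ t, IsSosLinear (P t))
    {μ : ι → ℂ} (hμ : ∀ i, ‖μ i‖ = 1) (B : ℕ) :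
    ∃ (K : ℕ) (u : (ι →₀ ℕ) → ℝ), Summable u ∧ ∀ᶠ k in cofinite,
      ∀ s ∈ Metric.closedBall (0 : Fin T → ℂ) B,
        ‖MvPowerSeries.coeff k (regFactor μ ^ K * zetaSeries P μ s)‖ ≤ u k := by
  obtain ⟨K, M, C, hC, hdec⟩ := decaysIn_zetaSeries hP hμ B (2 * Fintype.card ι)
  choose C' hC' hdec' using
    fun i => DecaysIn.regFactor_pow_mul μ i hC M (2 * Fintype.card ι) K
  refine ⟨K, fun k => (∑ i, C' i) * ∏ l, ((1 + (k l : ℝ)) ^ 2)⁻¹,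
    summable_prod_inv_sq.mul_left _, ?_⟩
  -- the differences are only controlled at points with a coordinate of size at least `M`
  have hfin : {k : ι →₀ ℕ | ∀ i, k i < M}.Finite := by
    refine Set.Finite.of_finite_image (f := fun k : ι →₀ ℕ => (k : ι → ℕ)) ?_
      DFunLike.coe_injective.injOn
    refine (Set.Finite.pi' fun _ : ι => Set.finite_Iio M).subset ?_
    rintro _ ⟨k, hk, rfl⟩
    exact hk
  filter_upwards [hfin.compl_mem_cofinite] with k hk s hs
  obtain ⟨j, hj⟩ : ∃ j, M ≤ k j := by
    by_contra! h
    exact hk h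
  obtain ⟨i, -, hi⟩ := Finset.exists_max_image Finset.univ (fun i => k i) ⟨j, Finset.mem_univ j⟩
  have h1 := hdec' i _ (hdec s (mem_closedBall_zero_iff.mp hs) i) k
    (hj.trans (hi j (Finset.mem_univ j)))
  refine h1.trans ?_
  rw [div_eq_mul_inv]
  refine mul_le_mul (Finset.single_le_sum (fun i _ => hC' i) (Finset.mem_univ i))
    (inv_pow_le_prod_inv_sq fun l => ?_) (by positivity)
    (Finset.sum_nonneg fun i _ => hC' i)
  have := hi l (Finset.mem_univ l)
  gcongr

theorem differentiable_coeff {P : Fin T → MvPolynomial ι ℝ} (hP : ∀ t, IsSosLinear (P t))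
    (μ : ι → ℂ) (H : MvPowerSeries ι ℂ) (k : ι →₀ ℕ) :
    Differentiable ℂ fun s => MvPowerSeries.coeff k (H * zetaSeries P μ s) := by
  classical
  have h : ∀ j : ι →₀ ℕ, Differentiable ℂ fun s : Fin T → ℂ =>
      ∏ t, ((eval (fun n => ((j n : ℝ) + 1)) (P t) : ℝ) : ℂ) ^ (-s t) := by
    intro j s
    refine (HasFDerivAt.finsetProd fun t _ => DifferentiableAt.hasFDerivAt ?_).differentiableAt
    refine DifferentiableAt.const_cpow (by fun_prop) (Or.inl ?_)
    exact Complex.ofReal_ne_zero.mpr ((hP t).eval_pos (add_one_mem_orthant _)).ne'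
  simp only [MvPowerSeries.coeff_mul, coeff_zetaSeries]
  exact Differentiable.fun_sum fun p _ => ((h p.2).const_mul _).const_mul _

/-- Absolute convergence of the series when all the real parts are large. -/
theorem summable_coeff_zetaSeries (hT : 0 < T) {P : Fin T → MvPolynomial ι ℝ}
    (hP : ∀ t, IsSosLinear (P t)) {μ : ι → ℂ} (hμ : ∀ i, ‖μ i‖ = 1) {s : Fin T → ℂ}
    (hs : ∀ t, ((2 * Fintype.card ι : ℕ) : ℝ) < (s t).re) :
    Summable fun k => ‖MvPowerSeries.coeff k (zetaSeries P μ s)‖ := by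
  obtain ⟨κ, hκP, hκ⟩ : ∃ κ, (∀ t, GrowthBounds κ (P t)) ∧ 1 ≤ κ :=
    ((eventually_all.2 fun t => (hP t).growthBounds).and (eventually_ge_atTop 1)).exists
  have hs0 : ∀ t, 0 ≤ (s t).re := fun t => (Nat.cast_nonneg _).trans (hs t).le
  refine Summable.of_nonneg_of_le (fun k => norm_nonneg _) (fun k => ?_)
    (summable_prod_inv_sq.mul_left (∏ t, κ ^ (s t).re))
  have hx := add_one_mem_orthant k
  have hkS := one_add_apply_le k
  have hS := sum_nonneg_of_mem_orthant hx
  rw [coeff_zetaSeries]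
  set x : ι → ℝ := fun l => (k l : ℝ) + 1
  set S := 1 + ∑ l, x l with hSdef
  have hS1 : 1 ≤ S := by linarith
  have hS0 : 0 < S := by linarith
  simp only [norm_mul, norm_prod, norm_pow, hμ, one_pow, Finset.prod_const_one, one_mul]
  have hterm : ∀ t, ‖((eval x (P t) : ℝ) : ℂ) ^ (-s t)‖ ≤ κ ^ (s t).re * S ^ (-(s t).re) := by
    intro t
    have hp := (hP t).eval_pos hx
    rw [Complex.norm_cpow_eq_rpow_re_of_pos hp, Complex.neg_re, Real.rpow_neg hp.le,
      ← Real.inv_rpow hp.le, Real.rpow_neg hS0.le, ← div_eq_mul_inv,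
      ← Real.div_rpow (by linarith) hS0.le]
    refine Real.rpow_le_rpow (by positivity) ?_ (hs0 t)
    rw [inv_le_comm₀ hp (by positivity), inv_div, div_le_iff₀ (by linarith), mul_comm]
    exact (hκP t).lower x hx
  calc ∏ t, ‖((eval x (P t) : ℝ) : ℂ) ^ (-s t)‖
      ≤ ∏ t, κ ^ (s t).re * S ^ (-(s t).re) :=
        Finset.prod_le_prod (fun t _ => norm_nonneg _) fun t _ => hterm t
    _ = (∏ t, κ ^ (s t).re) * S ^ (∑ t, -(s t).re) := by
        rw [Finset.prod_mul_distrib, Real.rpow_sum_of_pos hS0]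
    _ ≤ (∏ t, κ ^ (s t).re) * (S ^ (2 * Fintype.card ι))⁻¹ := by
        have hκ0 : 0 ≤ ∏ t, κ ^ (s t).re :=
          Finset.prod_nonneg fun t _ => Real.rpow_nonneg (by linarith) _
        refine mul_le_mul_of_nonneg_left ?_ hκ0
        rw [Finset.sum_neg_distrib, Real.rpow_neg hS0.le, ← Real.rpow_natCast]
        refine inv_anti₀ (by positivity) (Real.rpow_le_rpow_of_exponent_le hS1 ?_)
        exact (hs ⟨0, hT⟩).le.trans (Finset.single_le_sum (fun t _ => hs0 t)
          (Finset.mem_univ (⟨0, hT⟩ : Fin T)))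
    _ ≤ _ := by
        have hκ0 : 0 ≤ ∏ t, κ ^ (s t).re :=
          Finset.prod_nonneg fun t _ => Real.rpow_nonneg (by linarith) _
        exact mul_le_mul_of_nonneg_left (inv_pow_le_prod_inv_sq hkS) hκ0

/-- The points with positive coordinates, as exponents of the power series. -/
def posPointsEquiv (ι : Type*) [Fintype ι] : (ι →₀ ℕ) ≃ posPoints ι where
  toFun k := ⟨fun n => k n + 1, fun n => by simp⟩
  invFun m := Finsupp.equivFunOnFinite.symm fun n => m.1 n - 1
  left_inv k := by ext n; simp
  right_inv m := by
    ext n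
    have := m.2 n
    simp only [Finsupp.equivFunOnFinite_symm_apply_apply]
    omega

/-- The zeta series has an entire continuation, whose values are the regularized sums of the terms
of the series. The latter makes the values at negative integers accessible to algebra. -/
theorem exists_isEntireContinuation (hT : 0 < T) {P : Fin T → MvPolynomial ι ℝ}
    (hP : ∀ t, IsSosLinear (P t)) {μ : ι → ℂ} (hμ : ∀ i, ‖μ i‖ = 1 ∧ μ i ≠ 1) :
    ∃ F : (Fin T → ℂ) → ℂ, IsEntireContinuation (posPoints ι) 1 P μ F ∧
      ∀ s, RegularizedSum μ (zetaSeries P μ s) (F s) := by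
  choose K u hu hb using exists_majorant hP fun i => (hμ i).1
  have hsum : ∀ (B : ℕ), ∀ s ∈ Metric.closedBall (0 : Fin T → ℂ) B,
      RegularizedSum μ (zetaSeries P μ s)
        (∑' k, MvPowerSeries.coeff k (regFactor μ ^ K B * zetaSeries P μ s)) := by
    intro B s hs
    refine ⟨K B, Summable.hasSum (Summable.of_norm_bounded_eventually (hu B) ?_)⟩
    filter_upwards [hb B] with k hk
    exact hk s hs
  have hex : ∀ s, ∃ v, RegularizedSum μ (zetaSeries P μ s) v := fun s =>
    ⟨_, hsum ⌈‖s‖⌉₊ s (mem_closedBall_zero_iff.mpr (Nat.le_ceil _))⟩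
  choose F hF using hex
  refine ⟨F, ⟨fun s => ?_, (2 * Fintype.card ι : ℕ), fun s hs => ?_⟩, hF⟩
  · obtain ⟨B, hB⟩ := exists_nat_gt ‖s‖
    have hsB : s ∈ Metric.ball (0 : Fin T → ℂ) B := mem_ball_zero_iff.mpr hB
    refine (differentiableAt_tsum_of_norm_le (hu B)
      (fun k => differentiable_coeff hP μ (regFactor μ ^ K B) k) (hb B)
      hsB).congr_of_eventuallyEq ?_
    filter_upwards [Metric.isOpen_ball.mem_nhds hsB] with s' hs'
    exact (hF s').unique (fun i => (hμ i).2) (hsum B s' (Metric.ball_subset_closedBall hs'))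
  · have h := summable_coeff_zetaSeries hT hP (fun i => (hμ i).1) hs
    refine ⟨(posPointsEquiv ι).summable_iff.mp h, ?_⟩
    rw [← (posPointsEquiv ι).tsum_eq]
    exact (hF s).unique (fun i => (hμ i).2) ⟨0, by simpa using! h.of_norm.hasSum⟩

end Continuation

/-! ### Shifts and restrictions -/

section Substitution

theorem eval_aeval_polynomial {ι κ : Type*} (x : κ → ℝ) (g : ι → MvPolynomial κ ℝ)
    (P : MvPolynomial ι ℝ) : eval x (aeval g P) = eval (fun i => eval x (g i)) P := by
  induction P using MvPolynomial.induction_on with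
  | C c => simp
  | add p q hp hq => rw [map_add, map_add, hp, hq, map_add]
  | mul_X p i hp => rw [map_mul, map_mul, hp, aeval_X, map_mul, eval_X]

theorem eval_shift {ι : Type*} (a : ι → ℕ) (x : ι → ℝ) (P : MvPolynomial ι ℝ) :
    eval x (shift a P) = eval (fun n => x n + a n) P := by
  rw [shift, eval_aeval_polynomial]
  simp

/-- The point with coordinates `m_i + a_i` for `i ∈ I` and `b_i` for `i ∉ I`. -/
def glue {ι : Type*} [DecidableEq ι] (a : ι → ℕ) (I : Finset ι) (b : {i // i ∉ I} → ℕ)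
    (m : {i // i ∈ I} → ℕ) : ι → ℕ :=
  fun i => if h : i ∈ I then m ⟨i, h⟩ + a i else b ⟨i, h⟩

theorem eval_restrict {ι : Type*} [DecidableEq ι] (a : ι → ℕ) (I : Finset ι)
    (b : {i // i ∉ I} → ℕ) (m : {i // i ∈ I} → ℕ) (P : MvPolynomial ι ℝ) :
    eval (fun i => (m i : ℝ)) (restrict a I b P) = eval (fun i => (glue a I b m i : ℝ)) P := by
  rw [restrict, eval_aeval_polynomial]
  congr 2
  funext i
  simp only [glue]
  split_ifs <;> simp

variable {ι : Type*} [Fintype ι] {T : ℕ}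

theorem IsSosLinear.restrict [DecidableEq ι] {P : MvPolynomial ι ℝ} (hP : IsSosLinear P)
    (a : ι → ℕ) {I : Finset ι} (hI : I ≠ Finset.univ) {b : {i // i ∉ I} → ℕ} (hb : ∀ i, 1 ≤ b i) :
    IsSosLinear (restrict a I b P) := by
  obtain ⟨r, A, β, c, d, hc, hd, -, rfl⟩ := hP
  let e : ι → ℝ := fun i => if h : i ∈ I then (a i : ℝ) else (b ⟨i, h⟩ : ℝ)
  have he : ∀ i, 0 ≤ e i := fun i => by
    simp only [e]
    split_ifs <;> positivity
  obtain ⟨j, hj⟩ : ∃ j, j ∉ I := by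
    by_contra! h
    exact hI (Finset.eq_univ_iff_forall.mpr h)
  have hpos : 0 < ∑ n, c n * e n := by
    refine Finset.sum_pos' (fun n _ => mul_nonneg (hc n).le (he n)) ⟨j, Finset.mem_univ j, ?_⟩
    refine mul_pos (hc j) ?_
    simp only [e, dif_neg hj]
    exact_mod_cast hb ⟨j, hj⟩
  have hlin : ∀ A : ι → ℝ, TwistedZeta.restrict a I b (∑ n, C (A n) * X n) =
      ∑ n : {i // i ∈ I}, C (A n) * X n + C (∑ n, A n * e n) := by
    intro A
    have hsub : ∑ n : {i // i ∈ I}, C (A n) * (X n : MvPolynomial {i // i ∈ I} ℝ) =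
        ∑ n, C (A n) * (if h : n ∈ I then X ⟨n, h⟩ else 0) := by
      rw [← Finset.sum_subset (Finset.subset_univ I) fun n _ hn => by rw [dif_neg hn, mul_zero],
        ← Finset.sum_coe_sort I]
      exact Finset.sum_congr rfl fun n _ => by rw [dif_pos n.2]
    rw [TwistedZeta.restrict, map_sum, hsub, map_sum, ← Finset.sum_add_distrib]
    refine Finset.sum_congr rfl fun n _ => ?_
    rw [map_mul, aeval_X, algHom_C, C_mul, ← mul_add]
    congr 1
    simp only [e]
    split_ifs <;> simp
  refine ⟨r, fun k n => A k n, fun k => β k + ∑ n, A k n * e n, fun n => c n,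
    d + ∑ n, c n * e n, fun n => hc n, by linarith, Or.inl (by linarith), ?_⟩
  have hC : ∀ z, TwistedZeta.restrict a I b (C z) = C z := fun z => algHom_C _ z
  have hadd : ∀ p q, TwistedZeta.restrict a I b (p + q) =
      TwistedZeta.restrict a I b p + TwistedZeta.restrict a I b q := fun p q => map_add _ p q
  have hsum : ∀ f : Fin r → MvPolynomial ι ℝ, TwistedZeta.restrict a I b (∑ k, f k ^ 2) =
      ∑ k, (TwistedZeta.restrict a I b (f k)) ^ 2 := fun f => by
    simp only [TwistedZeta.restrict, map_sum, map_pow]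
  rw [hadd, hadd, hsum, hlin, hC, C_add]
  simp only [hadd, hlin, hC, C_add]
  have hcomm : ∀ k, (∑ n : {i // i ∈ I}, C (A k n) * X n + C (∑ n, A k n * e n) + C (β k) :
      MvPolynomial {i // i ∈ I} ℝ) =
      ∑ n : {i // i ∈ I}, C (A k n) * X n + (C (β k) + C (∑ n, A k n * e n)) := fun k => by ring
  simp only [hcomm]
  ring

theorem shift_eq_add_C {r : ℕ} {A : Fin r → ι → ℝ} {c : ι → ℝ} {d : ℝ} {a : ι → ℕ}
    (hA : ∀ k, ∑ n, A k n * (a n : ℝ) = 0) {P : MvPolynomial ι ℝ}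
    (hP : P = ∑ k, (∑ n, C (A k n) * X n) ^ 2 + ∑ n, C (c n) * X n + C d) :
    shift a P = P + C (∑ n, c n * (a n : ℝ)) := by
  have hlin : ∀ c : ι → ℝ, aeval (fun n => X n + C (a n : ℝ)) (∑ n, C (c n) * X n) =
      (∑ n, C (c n) * X n + C (∑ n, c n * (a n : ℝ)) : MvPolynomial ι ℝ) := by
    intro c
    rw [map_sum, map_sum, ← Finset.sum_add_distrib]
    refine Finset.sum_congr rfl fun n _ => ?_
    rw [map_mul, aeval_X, algHom_C, algebraMap_eq, C_mul, ← mul_add]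
  rw [shift, hP, map_add, map_add, map_sum, hlin, algHom_C, algebraMap_eq]
  simp only [map_pow, hlin, hA, C_0, add_zero]
  ring

theorem zetaTerm_add (P : Fin T → MvPolynomial ι ℝ) (μ : ι → ℂ) (s : Fin T → ℂ) (a m : ι → ℕ) :
    zetaTerm 1 P μ s (fun n => m n + a n) =
      (∏ n, μ n ^ a n) * zetaTerm 1 (fun t => shift a (P t)) μ s m := by
  simp only [zetaTerm, eval_shift, pow_add, Finset.prod_mul_distrib, map_one, Nat.cast_add]
  ring

theorem zetaTerm_glue [DecidableEq ι] (P : Fin T → MvPolynomial ι ℝ) (μ : ι → ℂ) (s : Fin T → ℂ)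
    (a : ι → ℕ) (I : Finset ι) (b : {i // i ∉ I} → ℕ) (m : {i // i ∈ I} → ℕ) :
    zetaTerm 1 P μ s (glue a I b m) =
      (∏ i : {i // i ∉ I}, μ i ^ b i) * (∏ i : {i // i ∈ I}, μ i ^ a i) *
        zetaTerm 1 (fun t => restrict a I b (P t)) (fun i => μ i) s m := by
  have h : ∏ n, μ n ^ glue a I b m n =
      (∏ i : {i // i ∈ I}, μ i ^ (m i + a i)) * ∏ i : {i // i ∉ I}, μ i ^ b i := by
    rw [← Fintype.prod_subtype_mul_prod_subtype (fun i => i ∈ I)]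
    congr 1
    · exact Finset.prod_congr (by ext; simp) fun i _ => by simp [glue, i.2]
    · exact Finset.prod_congr (by ext; simp) fun i _ => by simp [glue, i.2]
  simp only [zetaTerm, eval_restrict, h, pow_add, Finset.prod_mul_distrib, map_one]
  ring

end Substitution

/-! ### Decomposition of the lattice points -/

section Decomposition

theorem indicator_posPoints_eq {ι : Type*} (a : ι → ℕ) (g : (ι → ℕ) → ℂ) (m : ι → ℕ) :
    (posPoints ι).indicator g m = (boundarySet a).indicator g m +
      (Set.range fun (x : posPoints ι) n => x.1 n + a n).indicator g m := by
  classical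
  have hrange : m ∈ Set.range (fun (x : posPoints ι) n => x.1 n + a n) ↔ ∀ n, a n < m n := by
    constructor
    · rintro ⟨x, rfl⟩ n
      have := x.2 n
      simp only
      omega
    · intro h
      refine ⟨⟨fun n => m n - a n, fun n => ?_⟩, funext fun n => ?_⟩
      · have := h n
        dsimp only
        omega
      · have := h n
        simp only
        omega
  by_cases hpos : ∀ n, 1 ≤ m n
  · by_cases hE : ∃ n, m n ≤ a n
    · rw [Set.indicator_of_mem (show m ∈ posPoints ι from hpos),
        Set.indicator_of_mem (show m ∈ boundarySet a from ⟨hpos, hE⟩), Set.indicator_of_notMem,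
        add_zero]
      rw [hrange]
      push Not
      exact hE
    · rw [Set.indicator_of_mem (show m ∈ posPoints ι from hpos),
        Set.indicator_of_notMem (fun h : m ∈ boundarySet a => hE h.2), Set.indicator_of_mem,
        zero_add]
      rw [hrange]
      push Not at hE
      exact hE
  · rw [Set.indicator_of_notMem (show m ∉ posPoints ι from hpos),
      Set.indicator_of_notMem (fun h : m ∈ boundarySet a => hpos h.1), Set.indicator_of_notMem,
      add_zero]
    rw [hrange]
    exact fun h => hpos fun n => (Nat.zero_le _).trans_lt (h n)

variable {ι : Type*} [DecidableEq ι]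

theorem mem_range_glue_iff {a : ι → ℕ} {I : Finset ι} {b : {i // i ∉ I} → ℕ} {m : ι → ℕ} :
    m ∈ Set.range (fun x : posPoints {i // i ∈ I} => glue a I b x) ↔
      (∀ n ∈ I, a n < m n) ∧ ∀ n (h : n ∉ I), m n = b ⟨n, h⟩ := by
  constructor
  · rintro ⟨x, rfl⟩
    refine ⟨fun n hn => ?_, fun n hn => by simp [glue, hn]⟩
    have := x.2 ⟨n, hn⟩
    simp only [glue, dif_pos hn]
    omega
  · rintro ⟨h1, h2⟩
    refine ⟨⟨fun i => m i - a i, fun i => ?_⟩, ?_⟩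
    · have := h1 i i.2
      dsimp only
      omega
    · funext n
      by_cases hn : n ∈ I
      · have := h1 n hn
        simp only [glue, dif_pos hn]
        omega
      · simp only [glue, dif_neg hn, h2 n hn]

theorem glue_injective (a : ι → ℕ) (I : Finset ι) (b : {i // i ∉ I} → ℕ) :
    Function.Injective (fun x : posPoints {i // i ∈ I} => glue a I b x) := by
  intro x y h
  ext i
  have := congrFun h i
  simp only [glue, dif_pos i.2, Subtype.coe_eta] at this
  omega

variable [Fintype ι]

/-- `E(a)` is the disjoint union of the images of the maps `glue`: a point `m` lies in the image
given by the set `I` of the indices `n` with `m_n > a_n` and by the other coordinates of `m`. -/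
theorem sum_indicator_range_glue (a : ι → ℕ) (g : (ι → ℕ) → ℂ) (m : ι → ℕ) :
    ∑ I ∈ Finset.univ.erase (Finset.univ : Finset ι),
      ∑ b ∈ Fintype.piFinset (fun i : {i // i ∉ I} => Finset.Icc 1 (a i)),
        (Set.range fun x : posPoints {i // i ∈ I} => glue a I b x).indicator g m =
      (boundarySet a).indicator g m := by
  classical
  by_cases hm : m ∈ boundarySet a
  · obtain ⟨hpos, j, hj⟩ := hm
    let I₀ : Finset ι := Finset.univ.filter fun n => a n < m n
    have hI₀ : ∀ n, n ∈ I₀ ↔ a n < m n := fun n => by simp [I₀]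
    rw [Set.indicator_of_mem (show m ∈ boundarySet a from ⟨hpos, j, hj⟩),
      Finset.sum_eq_single_of_mem I₀, Finset.sum_eq_single_of_mem fun i : {i // i ∉ I₀} => m i]
    · rw [Set.indicator_of_mem]
      exact mem_range_glue_iff.mpr ⟨fun n hn => (hI₀ n).mp hn, fun n _ => rfl⟩
    · refine Fintype.mem_piFinset.mpr fun i => Finset.mem_Icc.mpr ⟨hpos i, ?_⟩
      have := (hI₀ i).not.mp i.2
      omega
    · intro b _ hb
      refine Set.indicator_of_notMem (fun h => hb ?_) _
      funext i
      exact ((mem_range_glue_iff.mp h).2 i i.2).symm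
    · refine Finset.mem_erase.mpr ⟨fun h => ?_, Finset.mem_univ _⟩
      have := (hI₀ j).mp (h ▸ Finset.mem_univ j)
      omega
    · intro I _ hI
      refine Finset.sum_eq_zero fun b hb => Set.indicator_of_notMem (fun h => hI ?_) _
      obtain ⟨h1, h2⟩ := mem_range_glue_iff.mp h
      ext n
      rw [hI₀]
      refine ⟨fun hn => h1 n hn, fun hn => ?_⟩
      by_contra hnI
      have := (Finset.mem_Icc.mp (Fintype.mem_piFinset.mp hb ⟨n, hnI⟩)).2
      rw [h2 n hnI] at hn
      exact absurd hn (not_lt.mpr this)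
  · rw [Set.indicator_of_notMem hm]
    refine Finset.sum_eq_zero fun I hI => Finset.sum_eq_zero fun b hb =>
      Set.indicator_of_notMem (fun h => hm ?_) _
    obtain ⟨h1, h2⟩ := mem_range_glue_iff.mp h
    have hb' := fun i => Finset.mem_Icc.mp (Fintype.mem_piFinset.mp hb i)
    obtain ⟨j, hj⟩ : ∃ j, j ∉ I := by
      by_contra! h
      exact (Finset.mem_erase.mp hI).1 (Finset.eq_univ_iff_forall.mpr h)
    refine ⟨fun n => ?_, j, ?_⟩
    · by_cases hn : n ∈ I
      · have := h1 n hn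
        omega
      · rw [h2 n hn]
        exact (hb' ⟨n, hn⟩).1
    · rw [h2 j hj]
      exact (hb' ⟨j, hj⟩).2

end Decomposition

/-! ### The relations between the continuations -/

section Relations

/-- The expansion of the values of the shifted zeta function at negative integers, for polynomials
which increase by constants under the shift. -/
theorem zetaSeries_add_C {ι : Type*} [Fintype ι] {T : ℕ} (P : Fin T → MvPolynomial ι ℝ)
    (μ : ι → ℂ) (δ : Fin T → ℝ) (k : Fin T → ℕ) :
    zetaSeries (fun t => P t + C (δ t)) μ (fun t => -(k t : ℂ)) =
      ∑ u ∈ Finset.Iic k, ((∏ t, (δ t : ℂ) ^ (k t - u t)) * ∏ t, ((k t).choose (u t) : ℂ)) •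
        zetaSeries P μ (fun t => -(u t : ℂ)) := by
  classical
  ext m
  simp only [map_sum, map_smul, coeff_zetaSeries, neg_neg, Complex.cpow_natCast, smul_eq_mul,
    map_add, eval_C, Complex.ofReal_add]
  set q : Fin T → ℂ := fun t => ((eval (fun n => (m n : ℝ) + 1) (P t) : ℝ) : ℂ) with hq
  have hbinom : ∀ t, (q t + δ t) ^ k t =
      ∑ u ∈ Finset.Iic (k t), δ t ^ (k t - u) * ((k t).choose u : ℂ) * q t ^ u := by
    intro t
    rw [add_pow, Nat.range_succ_eq_Iic]
    exact Finset.sum_congr rfl fun u _ => by ring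
  have hIic : Finset.Iic k = Fintype.piFinset fun t => Finset.Iic (k t) := by
    ext u
    simp [Pi.le_def]
  rw [Finset.prod_congr rfl fun t _ => hbinom t, Finset.prod_univ_sum, ← hIic, Finset.mul_sum]
  refine Finset.sum_congr rfl fun u _ => ?_
  simp only [Finset.prod_mul_distrib]
  ring

variable {N T : ℕ}

/-- The sum over `E(a)` of an absolutely convergent series is the sum of the zeta series in fewer
variables. -/
theorem hasSum_boundarySet (P : Fin T → MvPolynomial (Fin N) ℝ) (μ : Fin N → ℂ) (a : Fin N → ℕ)
    (s : Fin T → ℂ) {W : (I : Finset (Fin N)) → ({i // i ∉ I} → ℕ) → ℂ}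
    (hW : ∀ I : Finset (Fin N), I ≠ Finset.univ →
      ∀ b ∈ Fintype.piFinset (fun i : {i // i ∉ I} => Finset.Icc 1 (a i)),
        HasSum (fun m : posPoints {i // i ∈ I} =>
          zetaTerm 1 (fun t => restrict a I b (P t)) (fun i => μ i) s m) (W I b)) :
    HasSum ((boundarySet a).indicator (zetaTerm 1 P μ s))
      (∑ I ∈ Finset.univ.erase (Finset.univ : Finset (Fin N)),
        ∑ b ∈ Fintype.piFinset (fun i : {i // i ∉ I} => Finset.Icc 1 (a i)),
          (∏ i : {i // i ∉ I}, μ i ^ b i) * (∏ i : {i // i ∈ I}, μ i ^ a i) * W I b) := by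
  rw [← funext (sum_indicator_range_glue a (zetaTerm 1 P μ s))]
  refine hasSum_sum fun I hI => hasSum_sum fun b hb => ?_
  refine ((glue_injective a I b).hasSum_iff fun m hm => Set.indicator_of_notMem hm _).mp ?_
  convert! (hW I (Finset.mem_erase.mp hI).1 b hb).mul_left
    ((∏ i : {i // i ∉ I}, μ i ^ b i) * ∏ i : {i // i ∈ I}, μ i ^ a i) using 2 with x
  rw [Function.comp_apply, Set.indicator_of_mem (Set.mem_range_self x), zetaTerm_glue]

/-- Splitting off the points of `E(a)`, the remaining points are those of a shifted orthant. -/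
theorem eq_add_of_hasSum {P : Fin T → MvPolynomial (Fin N) ℝ} {μ : Fin N → ℂ} {a : Fin N → ℕ}
    {s : Fin T → ℂ} {z zbd zδ : ℂ}
    (hz : HasSum (fun m : posPoints (Fin N) => zetaTerm 1 P μ s m) z)
    (hbd : HasSum ((boundarySet a).indicator (zetaTerm 1 P μ s)) zbd)
    (hδ : HasSum (fun m : posPoints (Fin N) =>
      zetaTerm 1 (fun t => shift a (P t)) μ s m) zδ) :
    z = zbd + (∏ n, μ n ^ a n) * zδ := by
  set g := zetaTerm 1 P μ s with hg
  have hinj : Function.Injective fun (x : posPoints (Fin N)) n => x.1 n + a n := by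
    intro x y h
    ext n
    have := congrFun h n
    simp only at this
    omega
  have hshift : HasSum ((Set.range fun (x : posPoints (Fin N)) n => x.1 n + a n).indicator
      g) ((∏ n, μ n ^ a n) * zδ) := by
    refine (hinj.hasSum_iff fun m hm => Set.indicator_of_notMem hm _).mp ?_
    have hterm : (Set.range fun (x : posPoints (Fin N)) n => x.1 n + a n).indicator g ∘
        (fun (x : posPoints (Fin N)) n => x.1 n + a n) =
        fun x : posPoints (Fin N) =>
          (∏ n, μ n ^ a n) * zetaTerm 1 (fun t => shift a (P t)) μ s x := by
      funext x
      rw [Function.comp_apply, Set.indicator_of_mem (Set.mem_range_self x), hg, zetaTerm_add]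
    rw [hterm]
    exact hδ.mul_left _
  have h := hbd.add hshift
  rw [← funext (indicator_posPoints_eq a g)] at h
  have hz' : HasSum ((posPoints (Fin N)).indicator g) z := hasSum_subtype_iff_indicator.mp hz
  exact hz'.unique h

theorem IsEntireContinuation.exists_hasSum {ι : Type*} [Fintype ι] {E : Set (ι → ℕ)}
    {Q : MvPolynomial ι ℝ} {P : Fin T → MvPolynomial ι ℝ} {μ : ι → ℂ} {F : (Fin T → ℂ) → ℂ}
    (h : IsEntireContinuation E Q P μ F) :
    ∀ᶠ σ : ℝ in atTop, ∀ s : Fin T → ℂ, (∀ t, σ < (s t).re) →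
      HasSum (fun m : E => zetaTerm Q P μ s m) (F s) := by
  obtain ⟨-, σ₀, hσ⟩ := h
  filter_upwards [eventually_ge_atTop σ₀] with σ hle s hs
  obtain ⟨h1, h2⟩ := hσ s fun t => hle.trans_lt (hs t)
  rw [h2]
  exact h1.of_norm.hasSum

end Relations

end TwistedZeta

end

theorem corollary2 (N T : ℕ) (hT : 0 < T)
    (μ : Fin N → ℂ) (hμ : ∀ n, ‖μ n‖ = 1 ∧ μ n ≠ 1)
    (r : Fin T → ℕ) (α : (t : Fin T) → Fin (r t) → Fin N → ℝ)
    (c : Fin T → Fin N → ℝ) (hc : ∀ t n, 0 < c t n)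
    (d : Fin T → ℝ) (hd : ∀ t, 0 ≤ d t)
    (P : Fin T → MvPolynomial (Fin N) ℝ)
    (hP : ∀ t, P t = ∑ k, (∑ n, C (α t k n) * X n) ^ 2 + ∑ n, C (c t n) * X n + C (d t))
    (a : Fin N → ℕ) (ha : a ≠ 0) (hα : ∀ t k, ∑ n, α t k n * (a n : ℝ) = 0) :
    -- every polynomial is hypoelliptic
    (∀ t, TwistedZeta.Hypoelliptic (P t)) ∧
    -- every difference is a constant
    ∃ δ : Fin T → ℝ, (∀ t, TwistedZeta.diff a (P t) = C (δ t)) ∧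
    -- the series over all the points and the series over `E(a)` have entire continuations
    ∃ Z Zbd : (Fin T → ℂ) → ℂ,
      TwistedZeta.IsEntireContinuation (TwistedZeta.posPoints (Fin N)) 1 P μ Z ∧
      TwistedZeta.IsEntireContinuation (TwistedZeta.boundarySet a) 1 P μ Zbd ∧
      -- the recurrence relation
      (∀ k : Fin T → ℕ,
        (1 - ∏ n, μ n ^ a n) * Z (fun t => -(k t : ℂ)) =
          (∏ n, μ n ^ a n) *
            ∑ u ∈ Finset.Iio k, (∏ t, (δ t : ℂ) ^ (k t - u t)) * (∏ t, ((k t).choose (u t) : ℂ)) *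
              Z (fun t => -(u t : ℂ)) +
          Zbd (fun t => -(k t : ℂ))) ∧
      -- the series over `E(a)` in terms of zeta series in fewer variables
      ∃ W : (I : Finset (Fin N)) → ({i // i ∉ I} → ℕ) → (Fin T → ℂ) → ℂ,
        (∀ I : Finset (Fin N), I ≠ Finset.univ →
          ∀ b ∈ Fintype.piFinset (fun i : {i // i ∉ I} => Finset.Icc 1 (a i)),
            (∀ t, TwistedZeta.Hypoelliptic (TwistedZeta.restrict a I b (P t))) ∧
            TwistedZeta.IsEntireContinuation (TwistedZeta.posPoints {i // i ∈ I}) 1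
              (fun t => TwistedZeta.restrict a I b (P t)) (fun i => μ i) (W I b)) ∧
        ∀ s : Fin T → ℂ,
          Zbd s = ∑ I ∈ Finset.univ.erase (Finset.univ : Finset (Fin N)),
            ∑ b ∈ Fintype.piFinset (fun i : {i // i ∉ I} => Finset.Icc 1 (a i)),
              (∏ i : {i // i ∉ I}, μ i ^ b i) * (∏ i : {i // i ∈ I}, μ i ^ a i) * W I b s := by
  open TwistedZeta in
  have hN : Nonempty (Fin N) := by
    by_contra h
    rw [not_nonempty_iff] at h
    exact ha (Subsingleton.elim _ _)
  have hsos : ∀ t, IsSosLinear (P t) := fun t =>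
    ⟨r t, α t, fun _ => 0, c t, d t, hc t, hd t, Or.inr hN, by simpa using hP t⟩
  let δ : Fin T → ℝ := fun t => ∑ n, c t n * (a n : ℝ)
  have hδ0 : ∀ t, 0 ≤ δ t := fun t =>
    Finset.sum_nonneg fun n _ => mul_nonneg (hc t n).le (Nat.cast_nonneg _)
  have hshift : ∀ t, shift a (P t) = P t + C (δ t) := fun t => shift_eq_add_C (hα t) (hP t)
  have hsosδ : ∀ t, IsSosLinear (shift a (P t)) := fun t =>
    ⟨r t, α t, fun _ => 0, c t, d t + δ t, hc t, add_nonneg (hd t) (hδ0 t), Or.inr hN, by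
      rw [hshift, hP, C_add]
      simp only [C_0, add_zero]
      ring⟩
  have hsosr : ∀ I : Finset (Fin N), I ≠ Finset.univ →
      ∀ b ∈ Fintype.piFinset (fun i : {i // i ∉ I} => Finset.Icc 1 (a i)),
        ∀ t, IsSosLinear (restrict a I b (P t)) := fun I hI b hb t =>
    (hsos t).restrict a hI fun i => (Finset.mem_Icc.mp (Fintype.mem_piFinset.mp hb i)).1
  obtain ⟨Z, hZ, hZreg⟩ := exists_isEntireContinuation hT hsos hμ
  obtain ⟨Zδ, hZδ, hZδreg⟩ := exists_isEntireContinuation hT hsosδ hμ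
  have hWex : ∀ (I : Finset (Fin N)) (b : {i // i ∉ I} → ℕ), ∃ F : (Fin T → ℂ) → ℂ,
      I ≠ Finset.univ → b ∈ Fintype.piFinset (fun i : {i // i ∉ I} => Finset.Icc 1 (a i)) →
        IsEntireContinuation (posPoints {i // i ∈ I}) 1
          (fun t => restrict a I b (P t)) (fun i => μ i) F := by
    intro I b
    by_cases h : I ≠ Finset.univ ∧
      b ∈ Fintype.piFinset (fun i : {i // i ∉ I} => Finset.Icc 1 (a i))
    · obtain ⟨F, hF, -⟩ := exists_isEntireContinuation (μ := fun i : {i // i ∈ I} => μ i) hT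
        (hsosr I h.1 b h.2) fun i => hμ i
      exact ⟨F, fun _ _ => hF⟩
    · exact ⟨0, fun h1 h2 => absurd ⟨h1, h2⟩ h⟩
  choose W hW using hWex
  let Zbd : (Fin T → ℂ) → ℂ := fun s =>
    ∑ I ∈ Finset.univ.erase (Finset.univ : Finset (Fin N)),
      ∑ b ∈ Fintype.piFinset (fun i : {i // i ∉ I} => Finset.Icc 1 (a i)),
        (∏ i : {i // i ∉ I}, μ i ^ b i) * (∏ i : {i // i ∈ I}, μ i ^ a i) * W I b s
  have hZbd_diff : Differentiable ℂ Zbd := by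
    refine Differentiable.fun_sum fun I hI => Differentiable.fun_sum fun b hb => ?_
    exact (hW I b (Finset.mem_erase.mp hI).1 hb).1.const_mul _
  -- a common abscissa of absolute convergence for all the series in fewer variables
  have hWσ : ∀ᶠ σ : ℝ in atTop, ∀ I : Finset (Fin N),
      ∀ b ∈ Fintype.piFinset (fun i : {i // i ∉ I} => Finset.Icc 1 (a i)),
        I ≠ Finset.univ → ∀ s : Fin T → ℂ, (∀ t, σ < (s t).re) →
          HasSum (fun m : posPoints {i // i ∈ I} =>
            zetaTerm 1 (fun t => restrict a I b (P t)) (fun i => μ i) s m) (W I b s) := by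
    refine eventually_all.2 fun I => (Finset.eventually_all _).2 fun b hb => ?_
    by_cases hI : I = Finset.univ
    · exact Eventually.of_forall fun _ h => absurd hI h
    · filter_upwards [(hW I b hI hb).exists_hasSum] with σ hσ _
      exact hσ
  have hbd : ∀ᶠ σ : ℝ in atTop, ∀ s : Fin T → ℂ, (∀ t, σ < (s t).re) →
      HasSum ((boundarySet a).indicator (zetaTerm 1 P μ s)) (Zbd s) := by
    filter_upwards [hWσ] with σ hσ s hs
    exact hasSum_boundarySet P μ a s fun I hI b hb => hσ I b hb hI s hs
  -- the functional equation holds where the series converge, hence everywhere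
  have hfun : Z = fun s => Zbd s + (∏ n, μ n ^ a n) * Zδ s := by
    obtain ⟨σ, ⟨h1, h2⟩, h3⟩ := ((hZ.exists_hasSum.and hZδ.exists_hasSum).and hbd).exists
    exact eq_of_eq_of_re_large hZ.1 (hZbd_diff.add (hZδ.1.const_mul _)) (σ := σ)
      fun s hs => eq_add_of_hasSum (h1 s hs) (h3 s hs) (h2 s hs)
  have hval : ∀ k : Fin T → ℕ, Zδ (fun t => -(k t : ℂ)) =
      ∑ u ∈ Finset.Iic k, (∏ t, (δ t : ℂ) ^ (k t - u t)) * (∏ t, ((k t).choose (u t) : ℂ)) *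
        Z (fun t => -(u t : ℂ)) := by
    intro k
    have h := hZδreg fun t => -(k t : ℂ)
    rw [funext hshift, zetaSeries_add_C] at h
    exact h.unique (fun i => (hμ i).2) (RegularizedSum.sum (fun i => (hμ i).2) _
      fun u _ => (hZreg _).const_smul _)
  refine ⟨fun t => (hsos t).hypoelliptic, δ, fun t => ?_, Z, Zbd, hZ, ⟨hZbd_diff, ?_⟩,
    fun k => ?_, W, fun I hI b hb => ⟨fun t => (hsosr I hI b hb t).hypoelliptic, hW I b hI hb⟩,
    fun s => rfl⟩
  · rw [diff, hshift, add_sub_cancel_left]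
  · obtain ⟨σ, hσ⟩ := hbd.exists
    refine ⟨σ, fun s hs => ?_⟩
    have h := hasSum_subtype_iff_indicator.mpr (hσ s hs)
    exact ⟨h.summable.norm, h.tsum_eq.symm⟩
  · have h := congrFun hfun fun t => -(k t : ℂ)
    rw [hval, ← Finset.Iio_insert, Finset.sum_insert Finset.notMem_Iio_self] at h
    simp only [tsub_self, pow_zero, Nat.choose_self, Nat.cast_one, Finset.prod_const_one,
      one_mul] at h
    linear_combination h
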